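/- **Setting.** Let $\Sigma$ be a finite non-empty set of actions and $\mathcal P$ a set of fluent names. Simple literals are $f$ and $\neg f$ for $f\in\mathcal P$. Programs are $\pi ::= a \mid \pi_1+\pi_2\mid \pi_1;\pi_2\mid \pi^*$ ($a\in\Sigma$), with the usual language $[[\pi]]\subseteq\Sigma^*$. DLTL formulas are $\alpha ::= \top\mid\bot\mid p\mid\neg\alpha\mid\alpha\vee\beta\mid\alpha\,\mathcal U^{\pi}\beta$ ($p \in \mathcal P$). They are evaluated at the finite prefixes $\tau$ of $\sigma$ in a model $(\sigma,V)$, where $\sigma\in\Sigma^\omega$ and $V$ assigns to each finite prefix of $\sigma$ a subset of $\mathcal P$; $\alpha\,\mathcal U^\pi\beta$ holds at $\tau$ iff there is $\tau'\in[[\pi]]$ such that $\tau\tau'$ is a prefix of $\sigma$, $\beta$ holds at $\tau\tau'$, and $\alpha$ holds at $\tau\tau''$ for every proper prefix $\tau''$ of $\tau'$. A domain description is a pair $D=(\Pi,\mathcal C)$, with $\mathcal C$ a set of DLTL formulas and $\Pi$ a set of laws of the following forms: * action laws $\Box([a]l_0\leftarrow t_1,\dots,t_m,not\ t_{m+1},\dots,not\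 t_n)$, each $t_i$ being $l_i$ or $[a]l_i$; * dynamic causal laws $\Box(\bigcirc l_0\leftarrow t_1,\dots,t_m,not\ t_{m+1},\dots,not\ t_n)$, each $t_i$ being $l_i$ or $\bigcirc l_i$; * static causal laws $\Box(l_0\leftarrow l_1,\dots,l_m,not\ l_{m+1},\dots,not\ l_n)$ and initial state laws, of the same form without $\Box$, where the head may also be $\bot$; * precondition laws $\Box([a]\bot\leftarrow l_1,\dots,l_m,not\ l_{m+1},\dots,not\ l_n)$. Here all $l_i$ are simple literals. For every $f\in\mathcal P$, $\Pi$ contains the initial state laws $f\leftarrow not\ \neg f$ and $\neg f\leftarrow not\ f$. **Temporal answer sets.** A partial temporal interpretation is a pair $(\sigma,S)$ with $\sigma\in\Sigma^\omega$ and $S$ a set of literals $[\tau]l$ ($\tau$ a finite prefix of $\sigma$, $l$ simple) that never contains both $[\tau]f$ and $[\tau]\neg f$. At $\tau$, $l$ holds iff $[\tau]l\in S$; $[a]l$ holds iff $\tau a$ is not a prefix of $\sigma$ or $[\tau a]l\in S$; $\bigcirc l$ holds iff $[\tau b]l\in S$ for the $b$ such that $\tau b$ is a prefix of $\sigma$;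 $\bot$ never holds, and $[a]\bot$ holds iff $\tau a$ is not a prefix of $\sigma$. The reduct of $\Pi$ relative to $(\sigma,S)$ has, for each prefix $\tau$ (only $\tau=\varepsilon$ for initial state laws) and each law whose default-negated literals do not hold at $\tau$, the rule "if $t_1,\dots,t_m$ hold at $\tau$, then so does the head". $(\sigma,S)$ is a temporal answer set of $\Pi$ if $S$ is minimal among the $S'$ such that $(\sigma,S')$ is a partial temporal interpretation satisfying this reduct. Temporal answer sets over finite action words are defined in the same way, literals about the successor of the last state being vacuously satisfied. An interpretation is total if for all prefixes $\tau$ and all $f$ it contains $[\tau]f$ or $[\tau]\neg f$. $D$ is well-defined if all temporal answer sets of $\Pi$ (over infinite words) are total. An extension of $D$ is a total temporal answer set $(\sigma,S)$ of $\Pi$ whose temporal model $(\sigma,V_S)$, $V_S(\tau)=\{p:[\tau]p\in S\}$, satisfies every $\alpha\in\mathcal C$ at $\varepsilon$. **Translation.** For each program $\pi$ fix an $\varepsilon$-free nondeterministic finite automaton with an initial state that recognizes $[[\pi]]$, and let $t_\alpha$ be the term encoding the formula $\alpha$, until operators being written as $until(aut_\pi,q_0,t_\alpha,t_\beta)$ with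 $q_0$ the initial state. For $k\in\mathbb N$, $tr_k(D)$ is the ground program over the states $0,\dots,k+1$ consisting of: * facts $state(s)$ for $s\le k+1$, $action(a)$ for $a \in \Sigma$, $fluent(f)$ for $f \in \mathcal P$; * for $s\le k$: $\neg occurs(a,s)\leftarrow occurs(a_1,s),action(a),action(a_1),state(s)$ for $a\ne a_1$, and $occurs(a,s)\leftarrow not\ \neg occurs(a,s),action(a),state(s)$; * for each action law and each $s\le k$: $(\neg)holds(f_0,s+1)\leftarrow state(s),occurs(a,s),h_1,\dots,h_m,not\ h_{m+1},\dots,not\ h_n$, where $l_0=(\neg)f_0$, and $h_i$ is $(\neg)holds(f_i,s)$ if $t_i=(\neg)f_i$ and $(\neg)holds(f_i,s+1)$ if $t_i=[a](\neg)f_i$; for dynamic causal laws the same with $\bigcirc$ in place of $[a]$ and without $occurs(a,s)$; for static causal laws and each $s\le k+1$ the same without $occurs(a,s)$ and with $s$ in place of $s+1$ in the head; for initial state laws the corresponding rule in state $0$; a head $\bot$ gives a constraint, and a precondition law gives, for each $s \le k$, the constraint $\leftarrow state(s),occurs(a,s),h_1,\dots,h_m,not\ h_{m+1},\dots,not\ h_n$;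 * the loop rules: for $s\le k$, $\mathit{diff\_last}(s)\leftarrow state(s),fluent(f),holds(f,s),\neg holds(f,k+1)$; $\mathit{diff\_last}(s)\leftarrow state(s),fluent(f),holds(f,k+1),\neg holds(f,s)$; $\mathit{eq\_last}(s)\leftarrow state(s),not\ \mathit{diff\_last}(s)$; $next(k,s)\leftarrow state(s),not\ \neg next(k,s)$; for $s<k$, $next(s,s+1)\leftarrow state(s)$; for $s\neq s'$ in $\{0,\dots,k+1\}$, $\neg next(k,s)\leftarrow next(k,s'),state(s),state(s')$; and $\leftarrow next(k,s),not\ \mathit{eq\_last}(s)$ for $s \le k+1$; * for $s,s'\le k+1$, all terms $t,t'$ and all states $q,q'$ of the automaton $aut$ of a program: $sat(\top,s)\leftarrow state(s)$; $sat(f,s)\leftarrow fluent(f),holds(f,s)$; $sat(or(t,t'),s)\leftarrow sat(t,s)$; $sat(or(t,t'),s)\leftarrow sat(t',s)$; $sat(neg(t),s)\leftarrow state(s),not\ sat(t,s)$; $sat(until(aut,q,t,t'),s)\leftarrow final(aut,q),sat(t',s)$; $sat(until(aut,q,t,t'),s)\leftarrow sat(t,s),trans(aut,q,a,q'),occurs(a,s),next(s,s'),sat(until(aut,q',t,t'),s')$;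 facts $trans$ and $final$ describing the automata that index until operators in $\mathcal C$; and $\leftarrow not\ sat(t_\alpha,0)$ for each $\alpha\in\mathcal C$. An answer set is a consistent set $R$ of (classical) literals that is minimal among the consistent sets closed under the Gelfond–Lifschitz reduct of the program relative to $R$. We say that $R$ has complete states if for all $s\le k+1$ and all $f\in\mathcal P$ it contains $holds(f,s)$ or $\neg holds(f,s)$. A model $(\sigma,V)$ is a $k$-loop with back loop to $j$ if $0\le j\le k$ and actions and valuations are periodic from time $j$ on with period $k+1-j$. The model associated with an answer set $R$ with $next(k,j)\in R$ is the $k$-loop with back loop to $j$ whose action and true fluents at time $s\le k$ are given by the atoms $occurs(a,s)$ and $holds(p,s)$ of $R$. **Statement.** Let $D$ be a well-defined domain description and $k\in\mathbb N$. Then: 1. There is a bijection between the pairs $(E,j)$, where $E$ is an extension of $D$ whose temporal model is a $k$-loop with back loop to $j$, and the answer sets of $tr_k(D)$ with complete states. If $R$ corresponds to $(E,j)$, then $next(k,j)\in R$, and $E$ and $R$ are associated with the same temporal model. 2. An answer set $R$ of $tr_k(D)$ has complete states if and only if the state $j$ with $next(k,j)\in R$ contains the same literals as state $k+1$, that is,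 $(\neg)holds(f,j)\in R$ iff $(\neg)holds(f,k+1)\in R$ for every simple literal $(\neg)f$. 3. If moreover all temporal answer sets of $\Pi$ over finite action words are total, then every answer set of $tr_k(D)$ has complete states, so that the bijection in 1 is onto the set of all answer sets of $tr_k(D)$. -/

import Mathlib

namespace TemporalASP

/-! ### DLTL -/

/-- Programs (regular expressions) over the action alphabet. -/
inductive Prg (Act : Type*) where
  | atom (a : Act)
  | plus (π₁ π₂ : Prg Act)
  | seq (π₁ π₂ : Prg Act)
  | star (π : Prg Act)

/-- The set `[[π]]` of finite words associated with a program. -/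
def Prg.lang {Act : Type*} : Prg Act → Language Act
  | .atom a => {[a]}
  | .plus π₁ π₂ => π₁.lang + π₂.lang
  | .seq π₁ π₂ => π₁.lang * π₂.lang
  | .star π => KStar.kstar π.lang

/-- DLTL formulas; the propositions are `⊤`, `⊥` and the fluent names. -/
inductive DLTL (Act Flu : Type*) where
  | top
  | bot
  | fluent (p : Flu)
  | neg (α : DLTL Act Flu)
  | or (α β : DLTL Act Flu)
  | until (π : Prg Act) (α β : DLTL Act Flu)

/-- The programs that index the until operators of a formula. -/
def DLTL.programs {Act Flu : Type*} : DLTL Act Flu → Set (Prg Act)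
  | .top => ∅
  | .bot => ∅
  | .fluent _ => ∅
  | .neg α => α.programs
  | .or α β => α.programs ∪ β.programs
  | .until π α β => {π} ∪ α.programs ∪ β.programs

/-- A DLTL model `(σ, V)`.  The finite prefixes of the infinite word `σ` correspond one to one
to their lengths, so `V n` is the valuation at the prefix `σ 0 ⋯ σ (n - 1)`. -/
@[ext]
structure Model (Act Flu : Type*) where
  σ : ℕ → Act
  V : ℕ → Set Flu

/-- The finite word `σ n ⋯ σ (n + m - 1)`. -/
def segment {Act : Type*} (σ : ℕ → Act) (n m : ℕ) : List Act :=
  (List.range m).map fun i => σ (n + i)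

/-- `M, τ ⊨ α`, where `τ` is the prefix of length `n`. -/
def Model.Sat {Act Flu : Type*} (M : Model Act Flu) : ℕ → DLTL Act Flu → Prop
  | _, .top => True
  | _, .bot => False
  | n, .fluent p => p ∈ M.V n
  | n, .neg α => ¬ M.Sat n α
  | n, .or α β => M.Sat n α ∨ M.Sat n β
  | n, .until π α β => ∃ m, segment M.σ n m ∈ π.lang ∧ M.Sat (n + m) β ∧
      ∀ i < m, M.Sat (n + i) α

/-! ### Domain descriptions -/

/-- Simple fluent literals. -/
inductive FLit (Flu : Type*) where
  | pos (f : Flu)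
  | neg (f : Flu)

/-- Body literals of action laws and dynamic causal laws: a simple literal `l`, or a temporal
literal about the next state (`[a] l` in a law for action `a`, `◯ l` in a dynamic causal law). -/
inductive BLit (Flu : Type*) where
  | now (l : FLit Flu)
  | succ (l : FLit Flu)

/-- The laws `□ ([a] l₀ ← pos, not neg)`, `□ (◯ l₀ ← pos, not neg)`, `□ (l₀ ← pos, not neg)`,
`l₀ ← pos, not neg` and `□ ([a] ⊥ ← pos, not neg)`.  In static and initial state laws the head
`none` stands for `⊥` (state constraints). -/
inductive Law (Act Flu : Type*) where
  | action (a : Act) (l₀ : FLit Flu) (pos neg : List (BLit Flu))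
  | dynamic (l₀ : FLit Flu) (pos neg : List (BLit Flu))
  | static (l₀ : Option (FLit Flu)) (pos neg : List (FLit Flu))
  | initial (l₀ : Option (FLit Flu)) (pos neg : List (FLit Flu))
  | precondition (a : Act) (pos neg : List (FLit Flu))

/-- A domain description `(Π, C)`; `Π` contains, for every fluent `f`, the laws
`f ← not ¬f` and `¬f ← not f` completing the initial state. -/
structure DomainDescription (Act Flu : Type*) where
  laws : Set (Law Act Flu)
  constraints : Set (DLTL Act Flu)
  complete_pos : ∀ f, Law.initial (some (.pos f)) [] [.neg f] ∈ laws
  complete_neg : ∀ f, Law.initial (some (.neg f)) [] [.pos f] ∈ laws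

/-! ### Temporal answer sets -/

/-- Simple and temporal literals `l`, `[a] l`, `◯ l`, where `l` is a simple fluent literal
or `⊥` (represented by `none`). -/
inductive TLit (Act Flu : Type*) where
  | simple (l : Option (FLit Flu))
  | after (a : Act) (l : Option (FLit Flu))
  | next (l : Option (FLit Flu))

/-- A rule `□ (head ← pos, not neg)` if `boxed`, and `head ← pos, not neg` otherwise. -/
structure TRule (Act Flu : Type*) where
  boxed : Prop
  head : TLit Act Flu
  pos : List (TLit Act Flu)
  neg : List (TLit Act Flu)

/-- Body literals as temporal literals, `succ` being the modality `[a]` or `◯` of the law. -/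
def BLit.toTLit {Act Flu : Type*} (succ : Option (FLit Flu) → TLit Act Flu) :
    BLit Flu → TLit Act Flu
  | .now l => .simple (some l)
  | .succ l => succ (some l)

/-- The temporal rule which a law is. -/
def Law.rule {Act Flu : Type*} : Law Act Flu → TRule Act Flu
  | .action a l₀ pos neg =>
      ⟨True, .after a (some l₀), pos.map (BLit.toTLit (.after a)), neg.map (BLit.toTLit (.after a))⟩
  | .dynamic l₀ pos neg =>
      ⟨True, .next (some l₀), pos.map (BLit.toTLit .next), neg.map (BLit.toTLit .next)⟩
  | .static l₀ pos neg =>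
      ⟨True, .simple l₀, pos.map (fun l => .simple (some l)), neg.map (fun l => .simple (some l))⟩
  | .initial l₀ pos neg =>
      ⟨False, .simple l₀, pos.map (fun l => .simple (some l)), neg.map (fun l => .simple (some l))⟩
  | .precondition a pos neg =>
      ⟨True, .after a none, pos.map (fun l => .simple (some l)),
        neg.map (fun l => .simple (some l))⟩

/-- A pair `(σ, S)`, where `(n, l) ∈ S` stands for `[σ 0; …; σ (n - 1)] l ∈ S`. -/
@[ext]
structure TInterp (Act Flu : Type*) where
  σ : ℕ → Act
  S : Set (ℕ × FLit Flu)

/-- `(σ, S)` is a partial temporal interpretation over the word formed by the first `N` actions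
of `σ`, the whole infinite word if `N = ⊤`: the literals of `S` are about prefixes of that word,
and `S` is consistent. -/
def IsPartialInterp {Act Flu : Type*} (N : ℕ∞) (I : TInterp Act Flu) : Prop :=
  (∀ n l, (n, l) ∈ I.S → (n : ℕ∞) ≤ N) ∧
    ∀ n f, ¬ ((n, FLit.pos f) ∈ I.S ∧ (n, FLit.neg f) ∈ I.S)

/-- Every fluent has a value in every state, i.e. at every prefix of length `n ≤ N`. -/
def IsTotal {Act Flu : Type*} (N : ℕ∞) (I : TInterp Act Flu) : Prop :=
  ∀ n : ℕ, (n : ℕ∞) ≤ N → ∀ f, (n, FLit.pos f) ∈ I.S ∨ (n, FLit.neg f) ∈ I.S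

/-- Satisfaction of a simple literal or `⊥` at the prefix of length `n`. -/
def TInterp.SatSimple {Act Flu : Type*} (I : TInterp Act Flu) (n : ℕ) :
    Option (FLit Flu) → Prop
  | none => False
  | some l => (n, l) ∈ I.S

/-- Satisfaction of a literal at the prefix of length `n`.  For `N = ⊤` the condition
`n + 1 ≤ N` is void; for finite `N` the last state has no successor, and literals about its
successor are vacuously satisfied. -/
def TInterp.Sat {Act Flu : Type*} (N : ℕ∞) (I : TInterp Act Flu) (n : ℕ) : TLit Act Flu → Prop
  | .simple l => I.SatSimple n l
  | .after a l => ((n + 1 : ℕ) : ℕ∞) ≤ N → I.σ n = a → I.SatSimple (n + 1) l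
  | .next l => ((n + 1 : ℕ) : ℕ∞) ≤ N → I.SatSimple (n + 1) l

/-- A rule `[a₁; …; aₕ] (head ← body)` without default negation, where `a₁ … aₕ` is the prefix
of length `h = time`. -/
structure LocalRule (Act Flu : Type*) where
  time : ℕ
  head : TLit Act Flu
  body : List (TLit Act Flu)

/-- The reduct of a set of laws relative to `(σ, S)`: the union, over all prefixes, of the
instances whose default negations are true there; rules without `□` have only the instance at
the empty prefix. -/
def temporalReduct {Act Flu : Type*} (P : Set (Law Act Flu)) (N : ℕ∞) (I : TInterp Act Flu) :
    Set (LocalRule Act Flu) :=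
  {r | (r.time : ℕ∞) ≤ N ∧ ∃ law ∈ P, (law.rule.boxed ∨ r.time = 0) ∧
    r.head = law.rule.head ∧ r.body = law.rule.pos ∧
    ∀ t ∈ law.rule.neg, ¬ I.Sat N r.time t}

/-- `(σ, S)` satisfies all rules of `Q`. -/
def SatisfiesAll {Act Flu : Type*} (N : ℕ∞) (Q : Set (LocalRule Act Flu))
    (I : TInterp Act Flu) : Prop :=
  ∀ r ∈ Q, (∀ t ∈ r.body, I.Sat N r.time t) → I.Sat N r.time r.head

/-- `(σ, S)` is a temporal answer set of `P` over the word formed by the first `N` actions of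
`σ`: `S` is minimal among the `S₁` such that `(σ, S₁)` is a partial temporal interpretation
satisfying the rules of the reduct of `P` relative to `(σ, S)`. -/
def IsTemporalAnswerSet {Act Flu : Type*} (P : Set (Law Act Flu)) (N : ℕ∞)
    (I : TInterp Act Flu) : Prop :=
  Minimal (fun S₁ => IsPartialInterp N ⟨I.σ, S₁⟩ ∧
    SatisfiesAll N (temporalReduct P N I) ⟨I.σ, S₁⟩) I.S

/-- All temporal answer sets (over infinite action sequences) of the laws are total. -/
def DomainDescription.WellDefined {Act Flu : Type*} (D : DomainDescription Act Flu) : Prop :=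
  ∀ I, IsTemporalAnswerSet D.laws ⊤ I → IsTotal ⊤ I

/-- All temporal answer sets of the laws over finite action sequences are total. -/
def DomainDescription.FinitelyTotal {Act Flu : Type*} (D : DomainDescription Act Flu) : Prop :=
  ∀ (N : ℕ) (I : TInterp Act Flu), IsTemporalAnswerSet D.laws N I → IsTotal N I

/-- The temporal model `(σ, V_S)` of a total temporal interpretation `(σ, S)`. -/
def TInterp.model {Act Flu : Type*} (I : TInterp Act Flu) : Model Act Flu where
  σ := I.σ
  V n := {p | (n, FLit.pos p) ∈ I.S}

/-- Extensions of `D`: the total temporal answer sets of `Π`, over infinite action sequences,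
that satisfy the constraints in `C` at the initial state. -/
def DomainDescription.IsExtension {Act Flu : Type*} (D : DomainDescription Act Flu)
    (I : TInterp Act Flu) : Prop :=
  IsTemporalAnswerSet D.laws ⊤ I ∧ IsTotal ⊤ I ∧ ∀ α ∈ D.constraints, I.model.Sat 0 α

/-! ### Answer set programs -/

/-- Literals with classical negation. -/
inductive CLit (At : Type*) where
  | pos (x : At)
  | neg (x : At)

/-- A ground rule `head ← pos, not neg`; it is a constraint if `head = none`. -/
structure ASPRule (At : Type*) where
  head : Option (CLit At)
  pos : List (CLit At)
  neg : List (CLit At)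

/-- The Gelfond-Lifschitz reduct. -/
def aspReduct {At : Type*} (P : Set (ASPRule At)) (R : Set (CLit At)) : Set (ASPRule At) :=
  {r | ∃ r₀ ∈ P, (∀ l ∈ r₀.neg, l ∉ R) ∧ r = ⟨r₀.head, r₀.pos, []⟩}

/-- Closure of a set of literals under rules without default negation. -/
def AspClosed {At : Type*} (P : Set (ASPRule At)) (R : Set (CLit At)) : Prop :=
  ∀ r ∈ P, (∀ l ∈ r.pos, l ∈ R) → ∃ l ∈ r.head, l ∈ R

/-- No atom occurs together with its classical negation. -/
def AspConsistent {At : Type*} (R : Set (CLit At)) : Prop :=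
  ∀ x, ¬ (CLit.pos x ∈ R ∧ CLit.neg x ∈ R)

/-- (Consistent) answer sets. -/
def IsAnswerSet {At : Type*} (P : Set (ASPRule At)) (R : Set (CLit At)) : Prop :=
  Minimal (fun R₁ => AspConsistent R₁ ∧ AspClosed (aspReduct P R) R₁) R

/-! ### The translation -/

/-- An `ε`-free nondeterministic finite automaton with an initial state, recognizing `[[π]]`. -/
structure Automaton {Act : Type*} (π : Prg Act) where
  Q : Type
  finite : Finite Q
  δ : Q → Act → Set Q
  final : Set Q
  q₀ : Q
  recognizes : (NFA.mk δ {q₀} final).accepts = π.lang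

/-- Terms encoding DLTL formulas, until operators being indexed by the automaton chosen for a
program, with one of its states. -/
inductive Term {Act : Type*} (A : ∀ π : Prg Act, Automaton π) (Flu : Type*) where
  | top
  | bot
  | fluent (p : Flu)
  | neg (α : Term A Flu)
  | or (α β : Term A Flu)
  | until (π : Prg Act) (q : (A π).Q) (α β : Term A Flu)

/-- The term encoding a formula. -/
def DLTL.term {Act Flu : Type*} (A : ∀ π : Prg Act, Automaton π) : DLTL Act Flu → Term A Flu
  | .top => .top
  | .bot => .bot
  | .fluent p => .fluent p
  | .neg α => .neg (α.term A)
  | .or α β => .or (α.term A) (β.term A)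
  | .until π α β => .until π (A π).q₀ (α.term A) (β.term A)

/-- Ground atoms. -/
inductive Atom {Act : Type*} (A : ∀ π : Prg Act, Automaton π) (Flu : Type*) where
  | state (s : ℕ)
  | action (a : Act)
  | fluent (f : Flu)
  | occurs (a : Act) (s : ℕ)
  | holds (f : Flu) (s : ℕ)
  | diffLast (s : ℕ)
  | eqLast (s : ℕ)
  | next (s s₁ : ℕ)
  | trans (π : Prg Act) (q : (A π).Q) (a : Act) (q₁ : (A π).Q)
  | final (π : Prg Act) (q : (A π).Q)
  | sat (t : Term A Flu) (s : ℕ)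

section Translation

variable {Act Flu : Type*} (A : ∀ π : Prg Act, Automaton π)

/-- `(¬)holds(f, s)` for a simple literal `(¬)f`. -/
def holdsLit (s : ℕ) : FLit Flu → CLit (Atom A Flu)
  | .pos f => .pos (.holds f s)
  | .neg f => .neg (.holds f s)

/-- `(¬)holds(f, s)` for a simple literal, `(¬)holds(f, s + 1)` for a literal about the next
state. -/
def holdsBLit (s : ℕ) : BLit Flu → CLit (Atom A Flu)
  | .now l => holdsLit A s l
  | .succ l => holdsLit A (s + 1) l

/-- The ground instances of the translation of a law, for the states `0, …, k + 1`. -/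
def Law.tr (k : ℕ) : Law Act Flu → Set (ASPRule (Atom A Flu))
  | .action a l₀ pos neg =>
      {r | ∃ s ≤ k, r = ⟨some (holdsLit A (s + 1) l₀),
        .pos (.state s) :: .pos (.occurs a s) :: pos.map (holdsBLit A s),
        neg.map (holdsBLit A s)⟩}
  | .dynamic l₀ pos neg =>
      {r | ∃ s ≤ k, r = ⟨some (holdsLit A (s + 1) l₀),
        .pos (.state s) :: pos.map (holdsBLit A s), neg.map (holdsBLit A s)⟩}
  | .static l₀ pos neg =>
      {r | ∃ s ≤ k + 1, r = ⟨l₀.map (holdsLit A s),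
        .pos (.state s) :: pos.map (holdsLit A s), neg.map (holdsLit A s)⟩}
  | .initial l₀ pos neg =>
      {⟨l₀.map (holdsLit A 0), pos.map (holdsLit A 0), neg.map (holdsLit A 0)⟩}
  | .precondition a pos neg =>
      {r | ∃ s ≤ k, r = ⟨none,
        .pos (.state s) :: .pos (.occurs a s) :: pos.map (holdsLit A s),
        neg.map (holdsLit A s)⟩}

/-- The facts for the domain predicates. -/
inductive DomainFacts (k : ℕ) : ASPRule (Atom A Flu) → Prop
  | state (s : ℕ) (hs : s ≤ k + 1) : DomainFacts k ⟨some (.pos (.state s)), [], []⟩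
  | action (a : Act) : DomainFacts k ⟨some (.pos (.action a)), [], []⟩
  | fluent (f : Flu) : DomainFacts k ⟨some (.pos (.fluent f)), [], []⟩

/-- Exactly one action occurs in each of the states `0, …, k`. -/
inductive OccursRules (k : ℕ) : ASPRule (Atom A Flu) → Prop
  | neg_occurs (a a₁ : Act) (s : ℕ) (hs : s ≤ k) (ha : a ≠ a₁) : OccursRules k
      ⟨some (.neg (.occurs a s)),
        [.pos (.occurs a₁ s), .pos (.action a), .pos (.action a₁), .pos (.state s)], []⟩
  | occurs (a : Act) (s : ℕ) (hs : s ≤ k) : OccursRules k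
      ⟨some (.pos (.occurs a s)), [.pos (.action a), .pos (.state s)], [.neg (.occurs a s)]⟩

/-- The rules that detect the back loop from state `k` to a state equal to state `k + 1`. -/
inductive LoopRules (k : ℕ) : ASPRule (Atom A Flu) → Prop
  | diff_pos (f : Flu) (s : ℕ) (hs : s ≤ k) : LoopRules k
      ⟨some (.pos (.diffLast s)), [.pos (.state s), .pos (.fluent f),
        .pos (.holds f s), .neg (.holds f (k + 1))], []⟩
  | diff_neg (f : Flu) (s : ℕ) (hs : s ≤ k) : LoopRules k
      ⟨some (.pos (.diffLast s)), [.pos (.state s), .pos (.fluent f),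
        .pos (.holds f (k + 1)), .neg (.holds f s)], []⟩
  | eq_last (s : ℕ) (hs : s ≤ k) : LoopRules k
      ⟨some (.pos (.eqLast s)), [.pos (.state s)], [.pos (.diffLast s)]⟩
  | next_succ (s : ℕ) (hs : s < k) : LoopRules k
      ⟨some (.pos (.next s (s + 1))), [.pos (.state s)], []⟩
  | neg_next (s s₁ : ℕ) (hs : s ≤ k + 1) (hs₁ : s₁ ≤ k + 1) (hne : s ≠ s₁) : LoopRules k
      ⟨some (.neg (.next k s)), [.pos (.next k s₁), .pos (.state s), .pos (.state s₁)], []⟩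
  | next_last (s : ℕ) (hs : s ≤ k) : LoopRules k
      ⟨some (.pos (.next k s)), [.pos (.state s)], [.neg (.next k s)]⟩
  | constraint (s : ℕ) (hs : s ≤ k + 1) : LoopRules k
      ⟨none, [.pos (.next k s)], [.pos (.eqLast s)]⟩

/-- The definition of the predicate `sat`. -/
inductive SatRules (k : ℕ) : ASPRule (Atom A Flu) → Prop
  | top (s : ℕ) (hs : s ≤ k + 1) : SatRules k
      ⟨some (.pos (.sat .top s)), [.pos (.state s)], []⟩
  | fluent (f : Flu) (s : ℕ) (hs : s ≤ k + 1) : SatRules k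
      ⟨some (.pos (.sat (.fluent f) s)), [.pos (.fluent f), .pos (.holds f s)], []⟩
  | or_left (α β : Term A Flu) (s : ℕ) (hs : s ≤ k + 1) : SatRules k
      ⟨some (.pos (.sat (.or α β) s)), [.pos (.sat α s)], []⟩
  | or_right (α β : Term A Flu) (s : ℕ) (hs : s ≤ k + 1) : SatRules k
      ⟨some (.pos (.sat (.or α β) s)), [.pos (.sat β s)], []⟩
  | neg (α : Term A Flu) (s : ℕ) (hs : s ≤ k + 1) : SatRules k
      ⟨some (.pos (.sat (.neg α) s)), [.pos (.state s)], [.pos (.sat α s)]⟩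
  | until_final (π : Prg Act) (q : (A π).Q) (α β : Term A Flu) (s : ℕ) (hs : s ≤ k + 1) :
      SatRules k ⟨some (.pos (.sat (.until π q α β) s)),
        [.pos (.final π q), .pos (.sat β s)], []⟩
  | until_step (π : Prg Act) (q q₁ : (A π).Q) (a : Act) (α β : Term A Flu) (s s₁ : ℕ)
      (hs : s ≤ k + 1) (hs₁ : s₁ ≤ k + 1) :
      SatRules k ⟨some (.pos (.sat (.until π q α β) s)),
        [.pos (.sat α s), .pos (.trans π q a q₁), .pos (.occurs a s), .pos (.next s s₁),
          .pos (.sat (.until π q₁ α β) s₁)], []⟩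

/-- The facts describing the automata that index the until operators in the constraints, and
the requirement that the constraints are satisfied at the initial state. -/
inductive ConstraintRules (C : Set (DLTL Act Flu)) : ASPRule (Atom A Flu) → Prop
  | trans (γ : DLTL Act Flu) (hγ : γ ∈ C) (π : Prg Act) (hπ : π ∈ γ.programs)
      (q q₁ : (A π).Q) (a : Act) (h : q₁ ∈ (A π).δ q a) :
      ConstraintRules C ⟨some (.pos (.trans π q a q₁)), [], []⟩
  | final (γ : DLTL Act Flu) (hγ : γ ∈ C) (π : Prg Act) (hπ : π ∈ γ.programs)
      (q : (A π).Q) (h : q ∈ (A π).final) :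
      ConstraintRules C ⟨some (.pos (.final π q)), [], []⟩
  | constraint (γ : DLTL Act Flu) (hγ : γ ∈ C) :
      ConstraintRules C ⟨none, [], [.pos (.sat (γ.term A) 0)]⟩

/-- The ground program `tr(D)` for the bound `k`. -/
def DomainDescription.tr (D : DomainDescription Act Flu) (k : ℕ) :
    Set (ASPRule (Atom A Flu)) :=
  (⋃ law ∈ D.laws, law.tr A k) ∪ {r | DomainFacts A k r} ∪ {r | OccursRules A k r} ∪
    {r | LoopRules A k r} ∪ {r | SatRules A k r} ∪ {r | ConstraintRules A D.constraints r}

end Translation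

/-! ### `k`-loops -/

/-- The temporal model consists of the states `0, …, k` with a back loop from `k` to `j`. -/
def Model.IsKLoop {Act Flu : Type*} (k j : ℕ) (M : Model Act Flu) : Prop :=
  j ≤ k ∧ ∀ n, j ≤ n → M.σ (n + (k + 1 - j)) = M.σ n ∧ M.V (n + (k + 1 - j)) = M.V n

/-- The state among `0, …, k` that is visited at time `n` on the path with back loop from `k`
to `j`. -/
def loopState (k j n : ℕ) : ℕ := if n < j then n else j + (n - j) % (k + 1 - j)

/-- `M` is the temporal model `(σ_R, V_R)` associated with `R`, where `next(k, j) ∈ R`. -/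
def IsAssociatedModel {Act Flu : Type*} {A : ∀ π : Prg Act, Automaton π} (k j : ℕ)
    (R : Set (CLit (Atom A Flu))) (M : Model Act Flu) : Prop :=
  j ≤ k ∧ CLit.pos (Atom.next k j) ∈ R ∧
    ∀ n, CLit.pos (Atom.occurs (M.σ n) (loopState k j n)) ∈ R ∧
      ∀ p, p ∈ M.V n ↔ CLit.pos (Atom.holds p (loopState k j n)) ∈ R

/-- Every fluent has a value in each of the states `0, …, k + 1` of `R`. -/
def HasCompleteStates {Act Flu : Type*} {A : ∀ π : Prg Act, Automaton π} (k : ℕ)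
    (R : Set (CLit (Atom A Flu))) : Prop :=
  ∀ s ≤ k + 1, ∀ f, CLit.pos (Atom.holds f s) ∈ R ∨ CLit.neg (Atom.holds f s) ∈ R

/-- The state to which `R` loops back from state `k` contains the same literals as state
`k + 1`. -/
def IsLoopClosed {Act Flu : Type*} {A : ∀ π : Prg Act, Automaton π} (k : ℕ)
    (R : Set (CLit (Atom A Flu))) : Prop :=
  ∀ j, CLit.pos (Atom.next k j) ∈ R →
    ∀ l : FLit Flu, holdsLit A j l ∈ R ↔ holdsLit A (k + 1) l ∈ R

end TemporalASP

/-! The proof reduces both kinds of answer set to sequences of states. A law instance constrains one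
state through literals of that state and the one before it, so a sequence is an answer set of the
laws iff its initial state is a minimal solution of the initial instances and each later state is a
minimal solution of the instances about it, its predecessor being fixed (`isAnswerChain_iff`). Being
an answer set is thus local to transitions: sequences may be truncated (`IsAnswerChain.of_le`) and
unrolled along a back loop (`isTemporalAnswerSet_unroll`).

An answer set `R` of the translation chooses one action per state and one back loop. Its states `0,
…, k + 1` form an answer chain for these `k + 1` actions, and these data determine every other
literal (`IsAnswerSet.eq_loopAnswerSet`). Conversely, an answer chain whose states `j` and `k + 1`
are not complementary on any fluent, and in which the constraints hold, yields an answer set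
(`isAnswerSet_loopAnswerSet`). The `sat` atoms are correct because a well-founded derivation of an
until atom is an accepting run of the automaton along the looping path (`loopUntil_iff`,
`Model.sat_iff_eval`).

State `k + 1` is never entered by the loop; it only serves for comparison with state `j`. The
program excludes complementary literals in the two states, not a fluent known in only one of them.
With complete states this makes them equal, and the path unrolls to an extension. Conversely,
equality alone permits the unrolling, and well-definedness then gives completeness. For the last
claim no unrolling is needed: the states of `R` are a temporal answer set over a word of `k + 1`
actions. -/

namespace TemporalASP

/-! ### States and steps -/

section Steps

variable {Act Flu : Type*}

/-- No fluent is both true and false in the state `T`. -/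
def FConsistent (T : Set (FLit Flu)) : Prop := ∀ f, ¬ (FLit.pos f ∈ T ∧ FLit.neg f ∈ T)

/-- Satisfaction of a body literal in the transition from the state `s` to the state `s'`. -/
def BLit.Holds (s s' : Set (FLit Flu)) : BLit Flu → Prop
  | .now l => l ∈ s
  | .succ l => l ∈ s'

theorem BLit.Holds.mono {s s' t t' : Set (FLit Flu)} (h : s ⊆ t) (h' : s' ⊆ t') {b : BLit Flu}
    (hb : b.Holds s s') : b.Holds t t' := by
  cases b with
  | now l => exact h hb
  | succ l => exact h' hb

/-- The state `T` satisfies the instance of a law at the initial state in the reduct relative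
to the state `s`. -/
def Law.InitClosed (s T : Set (FLit Flu)) : Law Act Flu → Prop
  | .static l₀ pos neg => (∀ l ∈ neg, l ∉ s) → (∀ l ∈ pos, l ∈ T) → ∃ l ∈ l₀, l ∈ T
  | .initial l₀ pos neg => (∀ l ∈ neg, l ∉ s) → (∀ l ∈ pos, l ∈ T) → ∃ l ∈ l₀, l ∈ T
  | _ => True

/-- The transition from `T` to `T'` by the action `a` satisfies the instance of a law in the
reduct relative to the transition from `s` to `s'`. -/
def Law.StepClosed (a : Act) (s s' T T' : Set (FLit Flu)) : Law Act Flu → Prop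
  | .action b l₀ pos neg =>
      b = a → (∀ t ∈ neg, ¬ t.Holds s s') → (∀ t ∈ pos, t.Holds T T') → l₀ ∈ T'
  | .dynamic l₀ pos neg => (∀ t ∈ neg, ¬ t.Holds s s') → (∀ t ∈ pos, t.Holds T T') → l₀ ∈ T'
  | .static l₀ pos neg => (∀ l ∈ neg, l ∉ s') → (∀ l ∈ pos, l ∈ T') → ∃ l ∈ l₀, l ∈ T'
  | .initial _ _ _ => True
  | .precondition b pos neg => b = a → (∀ l ∈ neg, l ∉ s) → ¬ ∀ l ∈ pos, l ∈ T

/-- The earlier state of a candidate occurs only in positive bodies, never in a head. Hence one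
state of a chain can be shrunk without spoiling the transition that leaves it. -/
theorem Law.StepClosed.anti {a : Act} {s s' T U T' : Set (FLit Flu)} {law : Law Act Flu}
    (h : law.StepClosed a s s' U T') (hT : T ⊆ U) : law.StepClosed a s s' T T' := by
  cases law with
  | action b l₀ pos neg =>
    exact fun h₁ h₂ h₃ => h h₁ h₂ fun t ht => (h₃ t ht).mono hT subset_rfl
  | dynamic l₀ pos neg => exact fun h₂ h₃ => h h₂ fun t ht => (h₃ t ht).mono hT subset_rfl
  | static l₀ pos neg => exact h
  | initial l₀ pos neg => trivial
  | precondition b pos neg => exact fun h₁ h₂ h₃ => h h₁ h₂ fun l hl => hT (h₃ l hl)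

/-- `s` is an answer set of the instances of the laws at the initial state. -/
def IsInitState (P : Set (Law Act Flu)) (s : Set (FLit Flu)) : Prop :=
  Minimal (fun T => FConsistent T ∧ ∀ law ∈ P, law.InitClosed s T) s

/-- Given the state `s`, `s'` is an answer set of the instances of the laws that concern the
state reached by the action `a`. -/
def IsStep (P : Set (Law Act Flu)) (s : Set (FLit Flu)) (a : Act) (s' : Set (FLit Flu)) : Prop :=
  Minimal (fun T => FConsistent T ∧ ∀ law ∈ P, law.StepClosed a s s' s T) s'

/-- The sequence `st'` of states satisfies the reduct of the laws relative to `st`, for the word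
formed by the first `N` actions of `act`. -/
structure ChainClosed (P : Set (Law Act Flu)) (N : ℕ∞) (act : ℕ → Act)
    (st st' : ℕ → Set (FLit Flu)) : Prop where
  init : ∀ law ∈ P, law.InitClosed (st 0) (st' 0)
  step : ∀ n : ℕ, ((n + 1 : ℕ) : ℕ∞) ≤ N →
    ∀ law ∈ P, law.StepClosed (act n) (st n) (st (n + 1)) (st' n) (st' (n + 1))

/-- The sequence `st` of states is an answer set of the laws, for the word formed by the first
`N` actions of `act`. -/
structure IsAnswerChain (P : Set (Law Act Flu)) (N : ℕ∞) (act : ℕ → Act)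
    (st : ℕ → Set (FLit Flu)) : Prop where
  consistent : ∀ n : ℕ, (n : ℕ∞) ≤ N → FConsistent (st n)
  closed : ChainClosed P N act st st
  minimal : ∀ st' : ℕ → Set (FLit Flu), (∀ n, st' n ⊆ st n) → ChainClosed P N act st st' →
    ∀ n : ℕ, (n : ℕ∞) ≤ N → st n ⊆ st' n

theorem FConsistent.anti {T U : Set (FLit Flu)} (h : FConsistent U) (hT : T ⊆ U) :
    FConsistent T := fun f hf => h f ⟨hT hf.1, hT hf.2⟩

/-- A splitting theorem. A smaller candidate for a single state can be inserted into the chain,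
since by `Law.StepClosed.anti` the next transition stays closed, so global minimality gives local
minimality. Conversely, a smaller closed chain agrees with `st` state by state: once it agrees at
`n`, minimality of the step forces agreement at `n + 1`. -/
theorem isAnswerChain_iff {P : Set (Law Act Flu)} {N : ℕ∞} {act : ℕ → Act}
    {st : ℕ → Set (FLit Flu)} :
    IsAnswerChain P N act st ↔ IsInitState P (st 0) ∧
      ∀ n : ℕ, ((n + 1 : ℕ) : ℕ∞) ≤ N → IsStep P (st n) (act n) (st (n + 1)) := by
  classical
  constructor
  · intro h
    refine ⟨⟨⟨h.consistent 0 (by simp), h.closed.init⟩, fun T hT hle => ?_⟩,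
      fun n hn => ⟨⟨h.consistent _ hn, h.closed.step n hn⟩, fun T hT hle => ?_⟩⟩
    · have := h.minimal (Function.update st 0 T) ?_ ⟨?_, ?_⟩ 0 (by simp)
      · simpa using this
      · intro n
        rcases eq_or_ne n 0 with rfl | hn
        · simpa using hle
        · simp [hn]
      · simpa using hT.2
      · intro n hn law hlaw
        rw [Function.update_of_ne (by omega : n + 1 ≠ 0)]
        refine (h.closed.step n hn law hlaw).anti ?_
        rcases eq_or_ne n 0 with rfl | hn
        · simpa using hle
        · simp [hn]
    · have := h.minimal (Function.update st (n + 1) T) ?_ ⟨?_, ?_⟩ (n + 1) hn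
      · simpa using this
      · intro m
        rcases eq_or_ne m (n + 1) with rfl | hm
        · simpa using hle
        · simp [hm]
      · rw [Function.update_of_ne (by omega : 0 ≠ n + 1)]
        exact h.closed.init
      · intro m hm law hlaw
        rcases eq_or_ne m n with rfl | hmn
        · rw [Function.update_of_ne (by omega : m ≠ m + 1), Function.update_self]
          exact hT.2 law hlaw
        · rw [Function.update_of_ne (by omega : m + 1 ≠ n + 1)]
          refine (h.closed.step m hm law hlaw).anti ?_
          rcases eq_or_ne m (n + 1) with rfl | hm
          · simpa using hle
          · simp [hm]
  · rintro ⟨h₀, h₁⟩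
    refine ⟨?_, ⟨h₀.prop.2, fun n hn => (h₁ n hn).prop.2⟩, ?_⟩
    · intro n hn
      cases n with
      | zero => exact h₀.prop.1
      | succ n => exact (h₁ n hn).prop.1
    · intro st' hle hc n
      induction n with
      | zero => exact fun _ => h₀.le_of_le ⟨h₀.prop.1.anti (hle 0), hc.init⟩ (hle 0)
      | succ n ih =>
        intro hn
        have hn' : (n : ℕ∞) ≤ N := le_trans (by exact_mod_cast n.le_succ) hn
        -- Local minimality speaks of the predecessor `st n`, so the two chains must already
        -- coincide there.
        have e : st' n = st n := (hle n).antisymm (ih hn')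
        refine (h₁ n hn).le_of_le ⟨(h₁ n hn).prop.1.anti (hle _), fun law hlaw => ?_⟩ (hle _)
        simpa [e] using hc.step n hn law hlaw

theorem IsAnswerChain.of_le {P : Set (Law Act Flu)} {N M : ℕ∞} {act : ℕ → Act}
    {st : ℕ → Set (FLit Flu)} (h : IsAnswerChain P N act st) (hM : M ≤ N) :
    IsAnswerChain P M act st := by
  rw [isAnswerChain_iff] at h ⊢
  exact ⟨h.1, fun n hn => h.2 n (hn.trans hM)⟩

/-! ### Temporal answer sets as sequences of states -/

/-- The state at time `n`. -/
def slice (S : Set (ℕ × FLit Flu)) (n : ℕ) : Set (FLit Flu) := {l | (n, l) ∈ S}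

@[simp] theorem mem_slice {S : Set (ℕ × FLit Flu)} {n : ℕ} {l : FLit Flu} :
    l ∈ slice S n ↔ (n, l) ∈ S := Iff.rfl

theorem satSimple_iff {I : TInterp Act Flu} {n : ℕ} {l : Option (FLit Flu)} :
    I.SatSimple n l ↔ ∃ l' ∈ l, (n, l') ∈ I.S := by
  cases l <;> simp [TInterp.SatSimple]

/-- The bound `hn` rules out the last state of a finite word, where literals about the successor are
vacuously true. -/
theorem sat_toTLit_next {N : ℕ∞} {I : TInterp Act Flu} {n : ℕ}
    (hn : ((n + 1 : ℕ) : ℕ∞) ≤ N) (t : BLit Flu) :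
    I.Sat N n (t.toTLit .next) ↔ t.Holds (slice I.S n) (slice I.S (n + 1)) := by
  cases t with
  | now l => rfl
  | succ l => exact ⟨fun h => h hn, fun h _ => h⟩

theorem sat_toTLit_after {N : ℕ∞} {I : TInterp Act Flu} {n : ℕ}
    (hn : ((n + 1 : ℕ) : ℕ∞) ≤ N) (t : BLit Flu) :
    I.Sat N n (t.toTLit (.after (I.σ n))) ↔
      t.Holds (slice I.S n) (slice I.S (n + 1)) := by
  cases t with
  | now l => rfl
  | succ l => exact ⟨fun h => h hn rfl, fun h _ _ => h⟩

theorem satisfiesAll_temporalReduct {P : Set (Law Act Flu)} {N : ℕ∞} {I J : TInterp Act Flu} :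
    SatisfiesAll N (temporalReduct P N I) J ↔ ∀ law ∈ P, ∀ n : ℕ, (n : ℕ∞) ≤ N →
      (law.rule.boxed ∨ n = 0) → (∀ t ∈ law.rule.neg, ¬ I.Sat N n t) →
      (∀ t ∈ law.rule.pos, J.Sat N n t) → J.Sat N n law.rule.head := by
  constructor
  · intro h law hlaw n hn hb hneg hpos
    exact h ⟨n, law.rule.head, law.rule.pos⟩ ⟨hn, law, hlaw, hb, rfl, rfl, hneg⟩ hpos
  · rintro h ⟨n, hd, bd⟩ ⟨hn, law, hlaw, hb, h₁, h₂, hneg⟩ hpos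
    dsimp only at h₁ h₂ hpos hn hb hneg ⊢
    subst h₁ h₂
    exact h law hlaw n hn hb hneg hpos

/-- Each rule instance is assigned to the state that it constrains: a static law at time `n + 1`
belongs to the step from `n` to `n + 1`, one at time `0` to the initial state. Instances for an
action that does not occur, or beyond the last state, are vacuous. -/
theorem satisfiesAll_iff_chainClosed {P : Set (Law Act Flu)} {N : ℕ∞} {I : TInterp Act Flu}
    {S : Set (ℕ × FLit Flu)} :
    SatisfiesAll N (temporalReduct P N I) ⟨I.σ, S⟩ ↔
      ChainClosed P N I.σ (slice I.S) (slice S) := by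
  have hle : ∀ n : ℕ, ((n + 1 : ℕ) : ℕ∞) ≤ N → (n : ℕ∞) ≤ N := fun n hn =>
    le_trans (by exact_mod_cast n.le_succ) hn
  rw [satisfiesAll_temporalReduct]
  constructor
  · intro h
    refine ⟨fun law hlaw => ?_, fun n hn law hlaw => ?_⟩
    · have := h law hlaw 0 (by simp) (Or.inr rfl)
      cases law with
      | action b l₀ pos neg => trivial
      | dynamic l₀ pos neg => trivial
      | precondition b pos neg => trivial
      | static l₀ pos neg =>
        simpa [Law.rule, Law.InitClosed, TInterp.Sat, satSimple_iff] using this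
      | initial l₀ pos neg =>
        simpa [Law.rule, Law.InitClosed, TInterp.Sat, satSimple_iff] using this
    · cases law with
      | action b l₀ pos neg =>
        rintro rfl hneg hpos
        have := h _ hlaw n (hle n hn) (Or.inl trivial)
        simp only [Law.rule, List.forall_mem_map, sat_toTLit_after hn] at this
        exact this hneg hpos hn rfl
      | dynamic l₀ pos neg =>
        rintro hneg hpos
        have := h _ hlaw n (hle n hn) (Or.inl trivial)
        simp only [Law.rule, List.forall_mem_map, sat_toTLit_next hn] at this
        exact this hneg hpos hn
      | static l₀ pos neg =>
        have := h _ hlaw (n + 1) hn (Or.inl trivial)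
        simpa [Law.rule, Law.StepClosed, TInterp.Sat, satSimple_iff] using this
      | initial l₀ pos neg => trivial
      | precondition b pos neg =>
        rintro rfl hneg hpos
        have := h _ hlaw n (hle n hn) (Or.inl trivial)
        simp only [Law.rule, List.forall_mem_map] at this
        exact this hneg hpos hn rfl
  · intro h law hlaw n hn hb
    cases law with
    | action b l₀ pos neg =>
      rintro hneg hpos hn rfl
      simp only [Law.rule, List.forall_mem_map, sat_toTLit_after hn] at hneg hpos
      exact h.step n hn _ hlaw rfl hneg hpos
    | dynamic l₀ pos neg =>
      rintro hneg hpos hn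
      simp only [Law.rule, List.forall_mem_map, sat_toTLit_next hn] at hneg hpos
      exact h.step n hn _ hlaw hneg hpos
    | static l₀ pos neg =>
      have : Law.InitClosed (slice I.S n) (slice S n) (.static (Act := Act) l₀ pos neg) := by
        cases n with
        | zero => exact h.init _ hlaw
        | succ n => exact h.step n hn _ hlaw
      simpa [Law.rule, Law.InitClosed, TInterp.Sat, satSimple_iff] using this
    | initial l₀ pos neg =>
      obtain rfl : n = 0 := hb.resolve_left id
      have := h.init _ hlaw
      simpa [Law.rule, Law.InitClosed, TInterp.Sat, satSimple_iff] using this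
    | precondition b pos neg =>
      rintro hneg hpos hn rfl
      simp only [Law.rule, List.forall_mem_map] at hneg hpos
      exact h.step n hn _ hlaw rfl hneg hpos

theorem isPartialInterp_anti {N : ℕ∞} {σ : ℕ → Act} {S T : Set (ℕ × FLit Flu)}
    (h : IsPartialInterp N ⟨σ, S⟩) (hT : T ⊆ S) : IsPartialInterp N ⟨σ, T⟩ :=
  ⟨fun n l hl => h.1 n l (hT hl), fun n f hf => h.2 n f ⟨hT hf.1, hT hf.2⟩⟩

/-- The extra conjunct is needed because an answer chain says nothing about the states after time
`N`. -/
theorem isTemporalAnswerSet_iff {P : Set (Law Act Flu)} {N : ℕ∞} {I : TInterp Act Flu} :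
    IsTemporalAnswerSet P N I ↔ (∀ n l, (n, l) ∈ I.S → (n : ℕ∞) ≤ N) ∧
      IsAnswerChain P N I.σ (slice I.S) := by
  simp only [IsTemporalAnswerSet, satisfiesAll_iff_chainClosed]
  constructor
  · intro h
    refine ⟨h.prop.1.1, fun n _ => h.prop.1.2 n, h.prop.2, fun st' hle hc n hn l hl => ?_⟩
    have hsub : {x : ℕ × FLit Flu | x.2 ∈ st' x.1} ⊆ I.S := fun x hx => hle x.1 hx
    exact h.le_of_le (y := {x : ℕ × FLit Flu | x.2 ∈ st' x.1})
      ⟨isPartialInterp_anti h.prop.1 hsub, hc⟩ hsub hl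
  · rintro ⟨hN, h⟩
    refine ⟨⟨⟨hN, fun n f hf => h.consistent n (hN _ _ hf.1) f hf⟩, h.closed⟩, ?_⟩
    rintro T ⟨-, hT⟩ hle ⟨n, l⟩ hl
    exact h.minimal (slice T) (fun n l hl => hle hl) hT n (hN _ _ hl) hl

end Steps

/-! ### Answer sets of ground programs -/

section ASP

variable {At : Type*} {P : Set (ASPRule At)} {R R' : Set (CLit At)}

theorem aspClosed_aspReduct_iff :
    AspClosed (aspReduct P R) R' ↔ ∀ r ∈ P, (∀ l ∈ r.neg, l ∉ R) →
      (∀ l ∈ r.pos, l ∈ R') → ∃ l ∈ r.head, l ∈ R' := by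
  constructor
  · exact fun h r hr hneg hpos => h ⟨r.head, r.pos, []⟩ ⟨r, hr, hneg, rfl⟩ hpos
  · rintro h _ ⟨r, hr, hneg, rfl⟩ hpos
    exact h r hr hneg hpos

theorem AspClosed.head_mem (h : AspClosed (aspReduct P R) R') {l : CLit At}
    {pos neg : List (CLit At)} (hr : ⟨some l, pos, neg⟩ ∈ P) (hneg : ∀ l ∈ neg, l ∉ R)
    (hpos : ∀ l ∈ pos, l ∈ R') : l ∈ R' := by
  simpa using aspClosed_aspReduct_iff.1 h _ hr hneg hpos

theorem IsAnswerSet.not_constraint (h : IsAnswerSet P R) {pos neg : List (CLit At)}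
    (hr : ⟨none, pos, neg⟩ ∈ P) (hneg : ∀ l ∈ neg, l ∉ R) (hpos : ∀ l ∈ pos, l ∈ R) :
    False := by
  simpa using aspClosed_aspReduct_iff.1 h.prop.2 _ hr hneg hpos

/-- Induction on the derivation of the literals of an answer set. -/
theorem IsAnswerSet.induction (h : IsAnswerSet P R) {X : CLit At → Prop}
    (hX : ∀ r ∈ P, (∀ l ∈ r.neg, l ∉ R) → (∀ l ∈ r.pos, l ∈ R) → (∀ l ∈ r.pos, X l) →
      ∀ l ∈ r.head, l ∈ R → X l) : ∀ l ∈ R, X l := by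
  -- The literals of `R` satisfying `X` are consistent and closed under the reduct, so by minimality
  -- they are all of `R`.
  have := h.le_of_le (y := {l | l ∈ R ∧ X l})
    ⟨fun x hx => h.prop.1 x ⟨hx.1.1, hx.2.1⟩, aspClosed_aspReduct_iff.2 fun r hr hneg hpos => ?_⟩
    (fun l hl => hl.1)
  · exact fun l hl => (this hl).2
  · obtain ⟨l, hl, hlR⟩ :=
      aspClosed_aspReduct_iff.1 h.prop.2 r hr hneg fun l hl => (hpos l hl).1
    exact ⟨l, hl, hlR, hX r hr hneg (fun l hl => (hpos l hl).1) (fun l hl => (hpos l hl).2)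
      l hl hlR⟩

end ASP

/-! ### The rules of the translated program. -/

section Program

variable {Act Flu : Type*} {A : ∀ π : Prg Act, Automaton π} {D : DomainDescription Act Flu}
  {k : ℕ} {R R' : Set (CLit (Atom A Flu))}

theorem DomainDescription.mem_tr_iff {r : ASPRule (Atom A Flu)} :
    r ∈ D.tr A k ↔ (∃ law ∈ D.laws, r ∈ law.tr A k) ∨ DomainFacts A k r ∨ OccursRules A k r ∨
      LoopRules A k r ∨ SatRules A k r ∨ ConstraintRules A D.constraints r := by
  simp [DomainDescription.tr, or_assoc]

theorem DomainDescription.mem_tr_of_domainFacts {r : ASPRule (Atom A Flu)}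
    (h : DomainFacts A k r) : r ∈ D.tr A k := mem_tr_iff.2 (.inr (.inl h))

theorem DomainDescription.mem_tr_of_occursRules {r : ASPRule (Atom A Flu)}
    (h : OccursRules A k r) : r ∈ D.tr A k := mem_tr_iff.2 (.inr (.inr (.inl h)))

theorem DomainDescription.mem_tr_of_loopRules {r : ASPRule (Atom A Flu)}
    (h : LoopRules A k r) : r ∈ D.tr A k := mem_tr_iff.2 (.inr (.inr (.inr (.inl h))))

theorem DomainDescription.mem_tr_of_satRules {r : ASPRule (Atom A Flu)}
    (h : SatRules A k r) : r ∈ D.tr A k := mem_tr_iff.2 (.inr (.inr (.inr (.inr (.inl h)))))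

theorem DomainDescription.mem_tr_of_constraintRules {r : ASPRule (Atom A Flu)}
    (h : ConstraintRules A D.constraints r) : r ∈ D.tr A k :=
  mem_tr_iff.2 (.inr (.inr (.inr (.inr (.inr h)))))

open DomainDescription

/-! ### The states described by a set of ground literals -/

/-- The fluent literals that hold in state `s` of `R`. -/
def stateOf (R : Set (CLit (Atom A Flu))) (s : ℕ) : Set (FLit Flu) := {l | holdsLit A s l ∈ R}

@[simp] theorem mem_stateOf {s : ℕ} {l : FLit Flu} :
    l ∈ stateOf R s ↔ holdsLit A s l ∈ R := Iff.rfl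

theorem holdsBLit_mem_iff {s : ℕ} {t : BLit Flu} :
    holdsBLit A s t ∈ R ↔ t.Holds (stateOf R s) (stateOf R (s + 1)) := by
  cases t <;> rfl

/-- The translated laws read only `state`, `occurs` and fluent literals. Once the first two are
fixed in `R'`, closure depends only on the states of `R` and `R'`. Steps from `s ≤ k` correspond to
a word of length `k + 1`. -/
theorem laws_closed_iff {P : Set (Law Act Flu)} {act : ℕ → Act}
    (hstate : ∀ s ≤ k + 1, CLit.pos (Atom.state s) ∈ R')
    (hocc : ∀ s ≤ k, ∀ a, CLit.pos (Atom.occurs a s) ∈ R' ↔ a = act s) :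
    (∀ law ∈ P, ∀ r ∈ law.tr A k, (∀ l ∈ r.neg, l ∉ R) → (∀ l ∈ r.pos, l ∈ R') →
        ∃ l ∈ r.head, l ∈ R') ↔
      ChainClosed P ((k + 1 : ℕ) : ℕ∞) act (stateOf R) (stateOf R') := by
  have hstate' : ∀ s ≤ k, CLit.pos (Atom.state s) ∈ R' := fun s hs => hstate s (by omega)
  have hmap : ∀ s (l₀ : Option (FLit Flu)),
      (∃ l ∈ l₀.map (holdsLit A s), l ∈ R') ↔ ∃ l ∈ l₀, l ∈ stateOf R' s := by
    rintro s (_ | l) <;> simp [stateOf]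
  constructor
  · intro h
    refine ⟨fun law hlaw => ?_, fun s hs law hlaw => ?_⟩
    · have := h law hlaw
      cases law with
      | action b l₀ pos neg => trivial
      | dynamic l₀ pos neg => trivial
      | precondition b pos neg => trivial
      | static l₀ pos neg =>
        intro hneg hpos
        refine (hmap 0 l₀).1 (this _ ⟨0, by omega, rfl⟩ ?_ ?_)
        · simpa using hneg
        · simpa [hstate] using hpos
      | initial l₀ pos neg =>
        intro hneg hpos
        refine (hmap 0 l₀).1 (this _ rfl ?_ ?_)
        · simpa using hneg
        · simpa using hpos
    · have := h law hlaw
      replace hs : s ≤ k := by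
        have : s + 1 ≤ k + 1 := by exact_mod_cast hs
        omega
      cases law with
      | action b l₀ pos neg =>
        rintro rfl hneg hpos
        have := this _ ⟨s, hs, rfl⟩ ?_ ?_
        · simpa using this
        · simpa [holdsBLit_mem_iff] using hneg
        · simpa [holdsBLit_mem_iff, hstate' s hs, hocc s hs] using hpos
      | dynamic l₀ pos neg =>
        rintro hneg hpos
        have := this _ ⟨s, hs, rfl⟩ ?_ ?_
        · simpa using this
        · simpa [holdsBLit_mem_iff] using hneg
        · simpa [holdsBLit_mem_iff, hstate' s hs] using hpos
      | static l₀ pos neg =>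
        intro hneg hpos
        refine (hmap (s + 1) l₀).1 (this _ ⟨s + 1, by omega, rfl⟩ ?_ ?_)
        · simpa using hneg
        · simpa [hstate (s + 1) (by omega)] using hpos
      | initial l₀ pos neg => trivial
      | precondition b pos neg =>
        rintro rfl hneg hpos
        have := this _ ⟨s, hs, rfl⟩ ?_ ?_
        · simp at this
        · simpa using hneg
        · simpa [hstate' s hs, hocc s hs] using hpos
  · intro h law hlaw r hr hneg hpos
    have hcast : ∀ s ≤ k, ((s + 1 : ℕ) : ℕ∞) ≤ ((k + 1 : ℕ) : ℕ∞) := fun s hs => by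
      exact_mod_cast Nat.succ_le_succ hs
    cases law with
    | action b l₀ pos neg =>
      obtain ⟨s, hs, rfl⟩ := hr
      have := h.step s (hcast s hs) _ hlaw
      simp [holdsBLit_mem_iff, hstate' s hs, hocc s hs] at hneg hpos
      simpa using this hpos.1 hneg hpos.2
    | dynamic l₀ pos neg =>
      obtain ⟨s, hs, rfl⟩ := hr
      have := h.step s (hcast s hs) _ hlaw
      simp [holdsBLit_mem_iff, hstate' s hs] at hneg hpos
      simpa using this hneg hpos
    | static l₀ pos neg =>
      obtain ⟨s, hs, rfl⟩ := hr
      refine (hmap s l₀).2 ?_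
      simp [hstate s hs] at hneg hpos
      cases s with
      | zero => exact h.init _ hlaw hneg hpos
      | succ s => exact h.step s (hcast s (by omega)) _ hlaw hneg hpos
    | initial l₀ pos neg =>
      obtain rfl := hr
      refine (hmap 0 l₀).2 ?_
      simp at hneg hpos
      exact h.init _ hlaw hneg hpos
    | precondition b pos neg =>
      obtain ⟨s, hs, rfl⟩ := hr
      have := h.step s (hcast s hs) _ hlaw
      simp [hstate' s hs, hocc s hs] at hneg hpos
      exact (this hpos.1 hneg hpos.2).elim

/-- The heads of the translation of a law are literals about the states `0, …, k + 1`. -/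
theorem Law.head_of_mem_tr {law : Law Act Flu} {r : ASPRule (Atom A Flu)} (hr : r ∈ law.tr A k)
    {l : CLit (Atom A Flu)} (hl : l ∈ r.head) : ∃ s ≤ k + 1, ∃ l', l = holdsLit A s l' := by
  cases law with
  | action b l₀ pos neg =>
    obtain ⟨s, hs, rfl⟩ := hr
    simp at hl
    exact ⟨s + 1, by omega, l₀, hl.symm⟩
  | dynamic l₀ pos neg =>
    obtain ⟨s, hs, rfl⟩ := hr
    simp at hl
    exact ⟨s + 1, by omega, l₀, hl.symm⟩
  | static l₀ pos neg =>
    obtain ⟨s, hs, rfl⟩ := hr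
    cases l₀ with
    | none => simp at hl
    | some l₀ =>
      simp at hl
      exact ⟨s, hs, l₀, hl.symm⟩
  | initial l₀ pos neg =>
    obtain rfl := hr
    cases l₀ with
    | none => simp at hl
    | some l₀ =>
      simp at hl
      exact ⟨0, by omega, l₀, hl.symm⟩
  | precondition b pos neg =>
    obtain ⟨s, hs, rfl⟩ := hr
    simp at hl

/-! ### The loop answer set -/

/-- The successor of a state on the path with a back loop from `k` to `j`. -/
def NextState (k j s s₁ : ℕ) : Prop := s < k ∧ s₁ = s + 1 ∨ s = k ∧ s₁ = j

/-- Satisfaction, in a state of the path with a back loop from `k` to `j`, of an until formula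
indexed by an automaton with one of its states. -/
inductive LoopUntil {Q : Type*} (k j : ℕ) (act : ℕ → Act) (δ : Q → Act → Set Q) (F : Set Q)
    (α β : ℕ → Prop) : Q → ℕ → Prop
  | final (q : Q) (s : ℕ) (hq : q ∈ F) (hβ : β s) : LoopUntil k j act δ F α β q s
  | step (q q₁ : Q) (s s₁ : ℕ) (hs : NextState k j s s₁) (hq : q₁ ∈ δ q (act s)) (hα : α s)
      (h : LoopUntil k j act δ F α β q₁ s₁) : LoopUntil k j act δ F α β q s

/-- The transitions of the automata that index the until operators in `C`. -/
def transOf (A : ∀ π : Prg Act, Automaton π) (C : Set (DLTL Act Flu)) (π : Prg Act)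
    (q : (A π).Q) (a : Act) : Set (A π).Q :=
  {q₁ | (∃ γ ∈ C, π ∈ γ.programs) ∧ q₁ ∈ (A π).δ q a}

/-- The final states of the automata that index the until operators in `C`. -/
def finalOf (A : ∀ π : Prg Act, Automaton π) (C : Set (DLTL Act Flu)) (π : Prg Act) :
    Set (A π).Q :=
  {q | (∃ γ ∈ C, π ∈ γ.programs) ∧ q ∈ (A π).final}

/-- Satisfaction of a term in a state of the path with a back loop from `k` to `j`. -/
def Term.Eval (C : Set (DLTL Act Flu)) (k j : ℕ) (act : ℕ → Act) (st : ℕ → Set (FLit Flu)) :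
    Term A Flu → ℕ → Prop
  -- The bounds make this predicate agree with the `sat` atoms at every number `s`, as these are
  -- derived for `s ≤ k + 1` only.
  | .top, s => s ≤ k + 1
  | .bot, _ => False
  | .fluent p, s => s ≤ k + 1 ∧ FLit.pos p ∈ st s
  | .neg α, s => s ≤ k + 1 ∧ ¬ α.Eval C k j act st s
  | .or α β, s => α.Eval C k j act st s ∨ β.Eval C k j act st s
  | .until π q α β, s =>
      LoopUntil k j act (transOf A C π) (finalOf A C π) (α.Eval C k j act st)
        (β.Eval C k j act st) q s

theorem Term.Eval.le {C : Set (DLTL Act Flu)} {j : ℕ} {act : ℕ → Act}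
    {st : ℕ → Set (FLit Flu)} {t : Term A Flu} {s : ℕ} (h : t.Eval C k j act st s) :
    s ≤ k + 1 := by
  induction t with
  | top => exact h
  | bot => exact h.elim
  | fluent p => exact h.1
  | neg α _ => exact h.1
  | or α β hα hβ => exact h.elim hα hβ
  | _ π q α β hα hβ =>
    cases h with
    | final _ _ _ h => exact hβ h
    | step _ _ _ _ _ _ h _ => exact hα h

/-- States `s` and `k + 1` contain complementary literals. -/
def DiffLast (k : ℕ) (st : ℕ → Set (FLit Flu)) (s : ℕ) : Prop :=
  ∃ f, FLit.pos f ∈ st s ∧ FLit.neg f ∈ st (k + 1) ∨ FLit.pos f ∈ st (k + 1) ∧ FLit.neg f ∈ st s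

/-- The set of literals describing the path through the states `st 0, …, st (k + 1)`, with the
actions `act 0, …, act k` and a back loop from `k` to `j`. -/
def LoopLit (C : Set (DLTL Act Flu)) (k j : ℕ) (act : ℕ → Act) (st : ℕ → Set (FLit Flu)) :
    CLit (Atom A Flu) → Prop
  | .pos (.state s) => s ≤ k + 1
  | .pos (.action _) => True
  | .pos (.fluent _) => True
  | .pos (.occurs a s) => s ≤ k ∧ a = act s
  | .pos (.holds f s) => s ≤ k + 1 ∧ FLit.pos f ∈ st s
  | .pos (.diffLast s) => s ≤ k ∧ DiffLast k st s
  | .pos (.eqLast s) => s ≤ k ∧ ¬ DiffLast k st s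
  | .pos (.next s s₁) => NextState k j s s₁
  | .pos (.trans π q a q₁) => q₁ ∈ transOf A C π q a
  | .pos (.final π q) => q ∈ finalOf A C π
  | .pos (.sat t s) => t.Eval C k j act st s
  | .neg (.occurs a s) => s ≤ k ∧ a ≠ act s
  | .neg (.holds f s) => s ≤ k + 1 ∧ FLit.neg f ∈ st s
  -- State `k + 1` is included here: it is excluded as a target although it can never be chosen as
  -- one.
  | .neg (.next s s₁) => s = k ∧ s₁ ≤ k + 1 ∧ s₁ ≠ j
  | .neg _ => False

/-- The set of literals describing the path through the states `st 0, …, st (k + 1)`, with the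
actions `act 0, …, act k` and a back loop from `k` to `j`. -/
def loopAnswerSet (A : ∀ π : Prg Act, Automaton π) (C : Set (DLTL Act Flu)) (k j : ℕ)
    (act : ℕ → Act) (st : ℕ → Set (FLit Flu)) : Set (CLit (Atom A Flu)) :=
  {l | LoopLit C k j act st l}

/-! ### Actions and back loops of answer sets -/

/-- This and the following lemmas each apply rules of the program forwards. The set `R'` is kept
apart from `R` so that they serve both for an answer set itself and for the smaller candidates in
minimality arguments. -/
theorem AspClosed.state_mem (h : AspClosed (aspReduct (D.tr A k) R) R') {s : ℕ}
    (hs : s ≤ k + 1) :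
    CLit.pos (Atom.state s) ∈ R' :=
  h.head_mem (mem_tr_of_domainFacts (.state s hs)) (by simp) (by simp)

theorem AspClosed.action_mem (h : AspClosed (aspReduct (D.tr A k) R) R') (a : Act) :
    CLit.pos (Atom.action a) ∈ R' :=
  h.head_mem (mem_tr_of_domainFacts (.action a)) (by simp) (by simp)

theorem AspClosed.fluent_mem (h : AspClosed (aspReduct (D.tr A k) R) R') (f : Flu) :
    CLit.pos (Atom.fluent f) ∈ R' :=
  h.head_mem (mem_tr_of_domainFacts (.fluent f)) (by simp) (by simp)

theorem AspClosed.trans_mem (h : AspClosed (aspReduct (D.tr A k) R) R') {π : Prg Act}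
    {q q₁ : (A π).Q} {a : Act} (hq : q₁ ∈ transOf A D.constraints π q a) :
    CLit.pos (Atom.trans π q a q₁) ∈ R' := by
  obtain ⟨⟨γ, hγ, hπ⟩, hq⟩ := hq
  exact h.head_mem (mem_tr_of_constraintRules (.trans γ hγ π hπ q q₁ a hq)) (by simp) (by simp)

theorem AspClosed.final_mem (h : AspClosed (aspReduct (D.tr A k) R) R') {π : Prg Act}
    {q : (A π).Q} (hq : q ∈ finalOf A D.constraints π) :
    CLit.pos (Atom.final π q) ∈ R' := by
  obtain ⟨⟨γ, hγ, hπ⟩, hq⟩ := hq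
  exact h.head_mem (mem_tr_of_constraintRules (.final γ hγ π hπ q hq)) (by simp) (by simp)

theorem AspClosed.neg_occurs_mem (h : AspClosed (aspReduct (D.tr A k) R) R') {a a₁ : Act} {s : ℕ}
    (hs : s ≤ k) (hne : a ≠ a₁) (ha : CLit.pos (Atom.occurs a₁ s) ∈ R') :
    CLit.neg (Atom.occurs a s) ∈ R' := by
  refine h.head_mem (mem_tr_of_occursRules (.neg_occurs a a₁ s hs hne)) (by simp) ?_
  simp [ha, h.action_mem, h.state_mem (show s ≤ k + 1 by omega)]

theorem AspClosed.occurs_mem (h : AspClosed (aspReduct (D.tr A k) R) R') {a : Act} {s : ℕ}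
    (hs : s ≤ k) (ha : CLit.neg (Atom.occurs a s) ∉ R) : CLit.pos (Atom.occurs a s) ∈ R' := by
  refine h.head_mem (mem_tr_of_occursRules (.occurs a s hs)) (by simpa using ha) ?_
  simp [h.action_mem, h.state_mem (show s ≤ k + 1 by omega)]

theorem AspClosed.neg_next_mem (h : AspClosed (aspReduct (D.tr A k) R) R') {i j : ℕ}
    (hi : i ≤ k + 1) (hj : j ≤ k + 1) (hne : i ≠ j) (hn : CLit.pos (Atom.next k j) ∈ R') :
    CLit.neg (Atom.next k i) ∈ R' := by
  refine h.head_mem (mem_tr_of_loopRules (.neg_next i j hi hj hne)) (by simp) ?_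
  simp [hn, h.state_mem hi, h.state_mem hj]

theorem AspClosed.next_mem (h : AspClosed (aspReduct (D.tr A k) R) R') {j : ℕ}
    (hj : j ≤ k) (hn : CLit.neg (Atom.next k j) ∉ R) : CLit.pos (Atom.next k j) ∈ R' := by
  refine h.head_mem (mem_tr_of_loopRules (.next_last j hj)) (by simpa using hn) ?_
  simp [h.state_mem (show j ≤ k + 1 by omega)]

theorem AspClosed.next_succ_mem (h : AspClosed (aspReduct (D.tr A k) R) R') {s : ℕ}
    (hs : s < k) : CLit.pos (Atom.next s (s + 1)) ∈ R' := by
  refine h.head_mem (mem_tr_of_loopRules (.next_succ s hs)) (by simp) ?_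
  simp [h.state_mem (show s ≤ k + 1 by omega)]

theorem AspClosed.diffLast_mem (h : AspClosed (aspReduct (D.tr A k) R) R') {s : ℕ}
    (hs : s ≤ k) (hd : DiffLast k (stateOf R') s) : CLit.pos (Atom.diffLast s) ∈ R' := by
  obtain ⟨f, ⟨h₁, h₂⟩ | ⟨h₁, h₂⟩⟩ := hd
  · refine h.head_mem (mem_tr_of_loopRules (.diff_pos f s hs)) (by simp) ?_
    simp [h.state_mem (show s ≤ k + 1 by omega), h.fluent_mem]
    exact ⟨h₁, h₂⟩
  · refine h.head_mem (mem_tr_of_loopRules (.diff_neg f s hs)) (by simp) ?_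
    simp [h.state_mem (show s ≤ k + 1 by omega), h.fluent_mem]
    exact ⟨h₁, h₂⟩

theorem AspClosed.eqLast_mem (h : AspClosed (aspReduct (D.tr A k) R) R') {s : ℕ}
    (hs : s ≤ k) (hd : CLit.pos (Atom.diffLast s) ∉ R) : CLit.pos (Atom.eqLast s) ∈ R' := by
  refine h.head_mem (mem_tr_of_loopRules (.eq_last s hs)) (by simpa using hd) ?_
  simp [h.state_mem (show s ≤ k + 1 by omega)]

theorem AspClosed.sat_top_mem (h : AspClosed (aspReduct (D.tr A k) R) R') {s : ℕ}
    (hs : s ≤ k + 1) : CLit.pos (Atom.sat .top s) ∈ R' := by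
  refine h.head_mem (mem_tr_of_satRules (.top s hs)) (by simp) ?_
  simp [h.state_mem hs]

theorem AspClosed.sat_fluent_mem (h : AspClosed (aspReduct (D.tr A k) R) R') {s : ℕ} {f : Flu}
    (hs : s ≤ k + 1) (hf : CLit.pos (Atom.holds f s) ∈ R') :
    CLit.pos (Atom.sat (.fluent f) s) ∈ R' := by
  refine h.head_mem (mem_tr_of_satRules (.fluent f s hs)) (by simp) ?_
  simp [h.fluent_mem, hf]

theorem AspClosed.sat_neg_mem (h : AspClosed (aspReduct (D.tr A k) R) R') {s : ℕ}
    {α : Term A Flu} (hs : s ≤ k + 1) (hα : CLit.pos (Atom.sat α s) ∉ R) :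
    CLit.pos (Atom.sat (.neg α) s) ∈ R' := by
  refine h.head_mem (mem_tr_of_satRules (.neg α s hs)) (by simpa using hα) ?_
  simp [h.state_mem hs]

theorem AspClosed.sat_or_mem (h : AspClosed (aspReduct (D.tr A k) R) R') {s : ℕ}
    {α β : Term A Flu} (hs : s ≤ k + 1)
    (hαβ : CLit.pos (Atom.sat α s) ∈ R' ∨ CLit.pos (Atom.sat β s) ∈ R') :
    CLit.pos (Atom.sat (.or α β) s) ∈ R' := by
  rcases hαβ with hα | hβ
  · exact h.head_mem (mem_tr_of_satRules (.or_left α β s hs)) (by simp) (by simpa using hα)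
  · exact h.head_mem (mem_tr_of_satRules (.or_right α β s hs)) (by simp) (by simpa using hβ)

/-- Each constructor of `LoopUntil` is one application of an until rule. The predicates `Eα` and
`Eβ` are left abstract so that the lemma fits inside an induction on terms. -/
theorem AspClosed.sat_until_mem (h : AspClosed (aspReduct (D.tr A k) R) R') {j : ℕ} (hj : j ≤ k)
    {act : ℕ → Act} (hocc : ∀ s ≤ k, CLit.pos (Atom.occurs (act s) s) ∈ R')
    (hnext : CLit.pos (Atom.next k j) ∈ R') {π : Prg Act} {q : (A π).Q} {α β : Term A Flu}
    {s : ℕ} {Eα Eβ : ℕ → Prop} (hα : ∀ s, Eα s → CLit.pos (Atom.sat α s) ∈ R')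
    (hβ : ∀ s, Eβ s → s ≤ k + 1 ∧ CLit.pos (Atom.sat β s) ∈ R')
    (hu : LoopUntil k j act (transOf A D.constraints π) (finalOf A D.constraints π) Eα Eβ q s) :
    CLit.pos (Atom.sat (.until π q α β) s) ∈ R' := by
  induction hu with
  | final q s hq hs =>
    refine h.head_mem (mem_tr_of_satRules (.until_final π q α β s (hβ s hs).1)) (by simp) ?_
    simp [h.final_mem hq, (hβ s hs).2]
  | step q q₁ s s₁ hs hq hαs _ ih =>
    have hle : s ≤ k ∧ s₁ ≤ k + 1 := by
      rcases hs with ⟨h₁, rfl⟩ | ⟨rfl, rfl⟩ <;> omega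
    have hn : CLit.pos (Atom.next s s₁) ∈ R' := by
      rcases hs with ⟨h₁, rfl⟩ | ⟨rfl, rfl⟩
      · exact h.next_succ_mem h₁
      · exact hnext
    refine h.head_mem (mem_tr_of_satRules (.until_step π q q₁ (act s) α β s s₁
      (by omega) hle.2)) (by simp) ?_
    simp [h.trans_mem hq, hα s hαs, hn, ih, hocc s hle.1]

/-- The literals of an answer set are supported, except that `holds` and `sat` are described
here only as far as the bounds of their states are concerned. -/
def SupportedIn (C : Set (DLTL Act Flu)) (k : ℕ) (R : Set (CLit (Atom A Flu))) :
    CLit (Atom A Flu) → Prop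
  | .pos (.state s) => s ≤ k + 1
  | .pos (.action _) => True
  | .pos (.fluent _) => True
  | .pos (.occurs a s) => s ≤ k ∧ CLit.neg (Atom.occurs a s) ∉ R
  | .pos (.holds _ s) => s ≤ k + 1
  | .pos (.diffLast s) => s ≤ k ∧ DiffLast k (stateOf R) s
  | .pos (.eqLast s) => s ≤ k ∧ CLit.pos (Atom.diffLast s) ∉ R
  | .pos (.next s s₁) =>
      s < k ∧ s₁ = s + 1 ∨ s = k ∧ s₁ ≤ k ∧ CLit.neg (Atom.next k s₁) ∉ R
  | .pos (.trans π q a q₁) => q₁ ∈ transOf A C π q a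
  | .pos (.final π q) => q ∈ finalOf A C π
  | .pos (.sat _ s) => s ≤ k + 1
  | .neg (.occurs a s) => s ≤ k ∧ ∃ a₁ ≠ a, CLit.pos (Atom.occurs a₁ s) ∈ R
  | .neg (.holds _ s) => s ≤ k + 1
  | .neg (.next s s₁) => s = k ∧ s₁ ≤ k + 1 ∧ ∃ s₂ ≠ s₁, CLit.pos (Atom.next k s₂) ∈ R
  | .neg _ => False

/-- By minimality every literal is the head of a rule of the reduct whose body holds in `R`. -/
theorem IsAnswerSet.supportedIn (h : IsAnswerSet (D.tr A k) R) :
    ∀ l ∈ R, SupportedIn D.constraints k R l := by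
  refine h.induction fun r hr hneg hpos hX l hl _ => ?_
  rcases mem_tr_iff.1 hr with ⟨law, -, hr⟩ | hr | hr | hr | hr | hr
  · obtain ⟨s, hs, l', rfl⟩ := law.head_of_mem_tr hr hl
    cases l' <;> exact hs
  · cases hr <;> simp at hl <;> subst hl <;> simp_all [SupportedIn]
  · cases hr <;> simp at hl <;> subst hl <;> simp_all [SupportedIn]
    exact ⟨_, Ne.symm ‹_›, hpos.1⟩
  · cases hr <;> simp at hl <;> subst hl <;> simp_all [SupportedIn]
    · exact ⟨_, .inl hpos.2.2⟩
    · exact ⟨_, .inr hpos.2.2⟩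
    · exact ⟨_, Ne.symm ‹_›, hpos.1⟩
  · cases hr <;> simp at hl <;> subst hl <;> simp_all [SupportedIn]
  · cases hr <;> simp at hl <;> subst hl
    · exact ⟨⟨_, ‹_›, ‹_›⟩, ‹_›⟩
    · exact ⟨⟨_, ‹_›, ‹_›⟩, ‹_›⟩

/-- If no action occurred at `s`, no negated `occurs` atom would be supported and the default rule
would fire for any action. Two actions at `s` would contradict consistency. -/
theorem IsAnswerSet.exists_action [Nonempty Act] (h : IsAnswerSet (D.tr A k) R) :
    ∃ act : ℕ → Act, ∀ s ≤ k, ∀ a, CLit.pos (Atom.occurs a s) ∈ R ↔ a = act s := by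
  have key : ∀ s, ∃ b : Act, s ≤ k → ∀ a, CLit.pos (Atom.occurs a s) ∈ R ↔ a = b := by
    intro s
    by_cases hs : s ≤ k
    swap
    · exact ⟨Classical.arbitrary Act, fun h => (hs h).elim⟩
    have hex : ∃ b : Act, CLit.pos (Atom.occurs b s) ∈ R := by
      by_contra! hno
      have hneg : ∀ a, CLit.neg (Atom.occurs a s) ∉ R := fun a ha => by
        obtain ⟨-, a₁, -, h₁⟩ := h.supportedIn _ ha
        exact hno _ h₁
      exact hno (Classical.arbitrary Act) (AspClosed.occurs_mem h.prop.2 hs (hneg _))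
    obtain ⟨b, hb⟩ := hex
    refine ⟨b, fun _ a => ⟨fun ha => ?_, fun ha => ha ▸ hb⟩⟩
    by_contra hne
    exact h.prop.1 _ ⟨ha, AspClosed.neg_occurs_mem h.prop.2 hs hne hb⟩
  choose act hact using key
  exact ⟨act, hact⟩

theorem IsAnswerSet.next_le (h : IsAnswerSet (D.tr A k) R) {j : ℕ}
    (hj : CLit.pos (Atom.next k j) ∈ R) : j ≤ k := by
  rcases h.supportedIn _ hj with ⟨h₁, -⟩ | ⟨-, h₁, -⟩
  · omega
  · exact h₁

/-- The argument for actions again: without a chosen back loop nothing blocks the default rule, here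
tested at state `0`. -/
theorem IsAnswerSet.exists_next (h : IsAnswerSet (D.tr A k) R) :
    ∃ j ≤ k, CLit.pos (Atom.next k j) ∈ R := by
  by_contra! hno
  have hno' : ∀ j, CLit.pos (Atom.next k j) ∉ R := fun j hj => hno j (h.next_le hj) hj
  refine hno 0 (by omega) (AspClosed.next_mem h.prop.2 (by omega) fun hn => ?_)
  obtain ⟨-, -, s₂, -, h₂⟩ := h.supportedIn _ hn
  exact hno' _ h₂

theorem IsAnswerSet.next_unique (h : IsAnswerSet (D.tr A k) R) {i j : ℕ}
    (hi : CLit.pos (Atom.next k i) ∈ R) (hj : CLit.pos (Atom.next k j) ∈ R) : i = j := by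
  by_contra hne
  have h₁ := h.next_le hi
  have h₂ := h.next_le hj
  exact h.prop.1 _ ⟨hi, AspClosed.neg_next_mem h.prop.2 (by omega) (by omega) hne hj⟩

/-- The states of an answer set of the translation form an answer set of the laws, for the word
of its actions. -/
theorem IsAnswerSet.isAnswerChain (h : IsAnswerSet (D.tr A k) R) {act : ℕ → Act}
    (hocc : ∀ s ≤ k, ∀ a, CLit.pos (Atom.occurs a s) ∈ R ↔ a = act s) :
    IsAnswerChain D.laws ((k + 1 : ℕ) : ℕ∞) act (stateOf R) := by
  have hclosed := aspClosed_aspReduct_iff.1 h.prop.2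
  refine ⟨fun n _ f hf => h.prop.1 _ hf,
    (laws_closed_iff (fun s => AspClosed.state_mem h.prop.2) hocc).1
    fun law hlaw r hr => hclosed r (mem_tr_iff.2 (.inl ⟨law, hlaw, hr⟩)), ?_⟩
  intro st' hle hc n _
  -- The competitor to `R` keeps every literal that is not a fluent literal and cuts the fluent
  -- literals down to `st'`.
  let X : CLit (Atom A Flu) → Prop := fun l => ∀ s l', l = holdsLit A s l' → l' ∈ st' s
  have hX : stateOf {l | l ∈ R ∧ X l} = st' := by
    ext s l
    refine ⟨fun hl => hl.2 s l rfl, fun hl => ⟨hle s hl, fun s' l' e => ?_⟩⟩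
    cases l <;> cases l' <;> simp [holdsLit] at e <;> obtain ⟨rfl, rfl⟩ := e <;> exact hl
  have hfree : ∀ l : CLit (Atom A Flu), (∀ s l', l ≠ holdsLit A s l') → X l :=
    fun l hl s l' e => (hl s l' e).elim
  have hlaws := (laws_closed_iff (k := k) (R := R) (R' := {l | l ∈ R ∧ X l}) (P := D.laws)
    (act := act) (fun s hs => ⟨AspClosed.state_mem h.prop.2 hs, hfree _ ?_⟩)
    (fun s hs a => ?_)).2 (hX ▸ hc)
  · have := h.induction (X := X) fun r hr hneg hpos hposX l hl hlR => ?_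
    · exact fun l hl => this _ hl n l rfl
    · rcases mem_tr_iff.1 hr with ⟨law, hlaw, hr⟩ | hr | hr | hr | hr | hr
      · obtain ⟨l', hl', hl'X⟩ := hlaws law hlaw r hr hneg fun l hl => ⟨hpos l hl, hposX l hl⟩
        obtain rfl : l = l' := Option.mem_unique hl hl'
        exact hl'X.2
      -- Only the laws have fluent literals as heads, so all other rules preserve `X` trivially.
      all_goals
        refine hfree l ?_
        rintro s (f | f) rfl <;> cases hr <;> simp [holdsLit] at hl
  · rintro s (f | f) <;> simp [holdsLit]
  · rw [← hocc s hs a]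
    refine ⟨fun h => h.1, fun h => ⟨h, hfree _ ?_⟩⟩
    rintro s (f | f) <;> simp [holdsLit]

end Program

section Program

variable {Act Flu : Type*} {A : ∀ π : Prg Act, Automaton π} {D : DomainDescription Act Flu}
  {k : ℕ} {R R' : Set (CLit (Atom A Flu))}

open DomainDescription

/-! ### Every answer set is a loop answer set -/

/-- The literals `sat(t, s)` of an answer set are supported. -/
def SatSupported (C : Set (DLTL Act Flu)) (k j : ℕ) (act : ℕ → Act)
    (R : Set (CLit (Atom A Flu))) : CLit (Atom A Flu) → Prop
  | .pos (.sat .bot _) => False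
  | .pos (.sat (.fluent p) s) => CLit.pos (Atom.holds p s) ∈ R
  | .pos (.sat (.neg α) s) => CLit.pos (Atom.sat α s) ∉ R
  | .pos (.sat (.or α β) s) => CLit.pos (Atom.sat α s) ∈ R ∨ CLit.pos (Atom.sat β s) ∈ R
  | .pos (.sat (.until π q α β) s) =>
      LoopUntil k j act (transOf A C π) (finalOf A C π) (fun s => CLit.pos (Atom.sat α s) ∈ R)
        (fun s => CLit.pos (Atom.sat β s) ∈ R) q s
  | _ => True

theorem IsAnswerSet.next_iff (h : IsAnswerSet (D.tr A k) R) {j : ℕ}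
    (hj : CLit.pos (Atom.next k j) ∈ R) (s s₁ : ℕ) :
    CLit.pos (Atom.next s s₁) ∈ R ↔ NextState k j s s₁ := by
  constructor
  · intro hs
    rcases h.supportedIn _ hs with hs' | ⟨rfl, -⟩
    · exact .inl hs'
    · exact .inr ⟨rfl, h.next_unique hs hj⟩
  · rintro (⟨hs, rfl⟩ | ⟨rfl, rfl⟩)
    · exact AspClosed.next_succ_mem h.prop.2 hs
    · exact hj

/-- The until clause is inductive, so support here means a finite derivation; circular support
around the loop is excluded. -/
theorem IsAnswerSet.satSupported (h : IsAnswerSet (D.tr A k) R) {act : ℕ → Act} {j : ℕ}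
    (hocc : ∀ s ≤ k, ∀ a, CLit.pos (Atom.occurs a s) ∈ R ↔ a = act s)
    (hj : CLit.pos (Atom.next k j) ∈ R) :
    ∀ l ∈ R, SatSupported D.constraints k j act R l := by
  refine h.induction fun r hr hneg hpos hX l hl _ => ?_
  rcases mem_tr_iff.1 hr with ⟨law, -, hr⟩ | hr | hr | hr | hr | hr
  · obtain ⟨s, hs, l', rfl⟩ := law.head_of_mem_tr hr hl
    cases l' <;> trivial
  · cases hr <;> simp at hl <;> subst hl <;> trivial
  · cases hr <;> simp at hl <;> subst hl <;> trivial
  · cases hr <;> simp at hl <;> subst hl <;> trivial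
  · cases hr with
    | until_final π q α β s hs =>
      simp at hl hpos
      subst hl
      exact .final q s (h.supportedIn _ hpos.1) hpos.2
    | until_step π q q₁ a α β s s₁ hs hs₁ =>
      simp only [List.forall_mem_cons] at hpos hX
      simp at hl
      subst hl
      have hn := (h.next_iff hj s s₁).1 hpos.2.2.2.1
      have ha : a = act s := by
        refine (hocc s ?_ a).1 hpos.2.2.1
        rcases hn with ⟨hs, -⟩ | ⟨hs, -⟩ <;> omega
      subst ha
      -- The induction hypothesis is used for the last body atom, the until atom in the next state;
      -- the other body atoms are merely members of `R`.
      exact .step q q₁ s s₁ hn (h.supportedIn _ hpos.2.1) hpos.1 hX.2.2.2.2.1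
    | _ => simp at hl; subst hl; simp_all [SatSupported]
  · cases hr <;> simp at hl <;> subst hl <;> trivial

/-- Structural induction on the term, with support in one direction and rule application in the
other. Only the states up to `k + 1` must agree with `st`, which leaves `st` free to be an unrolled
path. -/
theorem IsAnswerSet.sat_iff (h : IsAnswerSet (D.tr A k) R) {act : ℕ → Act} {j : ℕ}
    (hocc : ∀ s ≤ k, ∀ a, CLit.pos (Atom.occurs a s) ∈ R ↔ a = act s)
    (hj : CLit.pos (Atom.next k j) ∈ R) {st : ℕ → Set (FLit Flu)}
    (hst : ∀ s ≤ k + 1, stateOf R s = st s) (t : Term A Flu) (s : ℕ) :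
    CLit.pos (Atom.sat t s) ∈ R ↔ t.Eval D.constraints k j act st s := by
  have hc := h.prop.2
  have hle : ∀ {t s}, CLit.pos (Atom.sat t s) ∈ R → s ≤ k + 1 := fun ht => h.supportedIn _ ht
  have hsup := h.satSupported hocc hj
  have hholds : ∀ s ≤ k + 1, ∀ f, CLit.pos (Atom.holds f s) ∈ R ↔ FLit.pos f ∈ st s :=
    fun s hs f => by rw [← hst s hs]; rfl
  induction t generalizing s with
  | top => exact ⟨hle, AspClosed.sat_top_mem hc⟩
  | bot => exact ⟨fun ht => hsup _ ht, fun ht => ht.elim⟩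
  | fluent p =>
    exact ⟨fun ht => ⟨hle ht, (hholds s (hle ht) p).1 (hsup _ ht)⟩,
      fun ht => AspClosed.sat_fluent_mem hc ht.1 ((hholds s ht.1 p).2 ht.2)⟩
  | neg α ih =>
    exact ⟨fun ht => ⟨hle ht, fun hα => hsup _ ht ((ih s).2 hα)⟩,
      fun ht => AspClosed.sat_neg_mem hc ht.1 fun hα => ht.2 ((ih s).1 hα)⟩
  | or α β ihα ihβ =>
    refine ⟨fun ht => (hsup _ ht).imp (ihα s).1 (ihβ s).1, fun ht =>
      AspClosed.sat_or_mem hc (Term.Eval.le ht) (ht.imp (ihα s).2 (ihβ s).2)⟩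
  | _ π q α β ihα ihβ =>
    refine ⟨fun ht => ?_, AspClosed.sat_until_mem hc (h.next_le hj)
      (fun s hs => (hocc s hs _).2 rfl) hj (fun s => (ihα s).2)
      fun s hs => ⟨hs.le, (ihβ s).2 hs⟩⟩
    have := hsup _ ht
    simp only [SatSupported, ihα, ihβ] at this
    exact this

/-- The loop constraint requires `eqLast j`, which is supported only if `diffLast j` is absent. A
fluent known in just one of the two states goes undetected. -/
theorem IsAnswerSet.not_diffLast (h : IsAnswerSet (D.tr A k) R) {j : ℕ}
    (hj : CLit.pos (Atom.next k j) ∈ R) : ¬ DiffLast k (stateOf R) j := by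
  have hjk := h.next_le hj
  intro hd
  refine h.not_constraint (mem_tr_of_loopRules (.constraint j (by omega))) ?_ (by simpa using hj)
  simp only [List.mem_singleton, forall_eq]
  exact fun he => (h.supportedIn _ he).2 (AspClosed.diffLast_mem h.prop.2 hjk hd)

theorem IsAnswerSet.sat_term_mem (h : IsAnswerSet (D.tr A k) R) {γ : DLTL Act Flu}
    (hγ : γ ∈ D.constraints) : CLit.pos (Atom.sat (γ.term A) 0) ∈ R := by
  by_contra hs
  exact h.not_constraint (mem_tr_of_constraintRules (.constraint γ hγ)) (by simpa using hs)
    (by simp)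

theorem diffLast_congr {st st' : ℕ → Set (FLit Flu)} (hst : ∀ s ≤ k + 1, st s = st' s) {s : ℕ}
    (hs : s ≤ k) : DiffLast k st s ↔ DiffLast k st' s := by
  rw [DiffLast, DiffLast, hst s (by omega), hst (k + 1) le_rfl]

/-- Actions, back loop and states `0, …, k + 1` determine an answer set: each remaining atom has its
support on one side and its rule on the other. -/
theorem IsAnswerSet.eq_loopAnswerSet (h : IsAnswerSet (D.tr A k) R) {act : ℕ → Act} {j : ℕ}
    (hocc : ∀ s ≤ k, ∀ a, CLit.pos (Atom.occurs a s) ∈ R ↔ a = act s)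
    (hj : CLit.pos (Atom.next k j) ∈ R) {st : ℕ → Set (FLit Flu)}
    (hst : ∀ s ≤ k + 1, stateOf R s = st s) :
    R = loopAnswerSet A D.constraints k j act st := by
  have hc := h.prop.2
  have hsup := h.supportedIn
  have hjk := h.next_le hj
  have hmem : ∀ s ≤ k + 1, ∀ l, holdsLit A s l ∈ R ↔ l ∈ st s :=
    fun s hs f => by rw [← hst s hs]; rfl
  have hdiff := fun s (hs : s ≤ k) => diffLast_congr hst hs
  ext l
  change l ∈ R ↔ LoopLit D.constraints k j act st l
  rcases l with x | x
  · cases x with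
    | state s => exact ⟨hsup _, AspClosed.state_mem hc⟩
    | action a => exact ⟨fun _ => trivial, fun _ => AspClosed.action_mem hc a⟩
    | fluent f => exact ⟨fun _ => trivial, fun _ => AspClosed.fluent_mem hc f⟩
    | occurs a s =>
      exact ⟨fun hl => ⟨(hsup _ hl).1, (hocc s (hsup _ hl).1 a).1 hl⟩,
        fun hl => (hocc s hl.1 a).2 hl.2⟩
    | holds f s =>
      exact ⟨fun hl => ⟨hsup _ hl, (hmem s (hsup _ hl) (.pos f)).1 hl⟩,
        fun hl => (hmem s hl.1 (.pos f)).2 hl.2⟩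
    | diffLast s =>
      exact ⟨fun hl => ⟨(hsup _ hl).1, (hdiff s (hsup _ hl).1).1 (hsup _ hl).2⟩,
        fun hl => AspClosed.diffLast_mem hc hl.1 ((hdiff s hl.1).2 hl.2)⟩
    | eqLast s =>
      exact ⟨fun hl => ⟨(hsup _ hl).1, fun hd => (hsup _ hl).2
          (AspClosed.diffLast_mem hc (hsup _ hl).1 ((hdiff s (hsup _ hl).1).2 hd))⟩,
        fun hl => AspClosed.eqLast_mem hc hl.1 fun hd =>
          hl.2 ((hdiff s hl.1).1 (hsup _ hd).2)⟩
    | next s s₁ => exact h.next_iff hj s s₁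
    | trans π q a q₁ => exact ⟨hsup _, AspClosed.trans_mem hc⟩
    | final π q => exact ⟨hsup _, AspClosed.final_mem hc⟩
    | sat t s => exact h.sat_iff hocc hj hst t s
  · cases x with
    | occurs a s =>
      refine ⟨fun hl => ⟨(hsup _ hl).1, fun ha => ?_⟩,
        fun hl => AspClosed.neg_occurs_mem hc hl.1 hl.2 ((hocc s hl.1 _).2 rfl)⟩
      exact h.prop.1 _ ⟨(hocc s (hsup _ hl).1 a).2 ha, hl⟩
    | holds f s =>
      exact ⟨fun hl => ⟨hsup _ hl, (hmem s (hsup _ hl) (.neg f)).1 hl⟩,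
        fun hl => (hmem s hl.1 (.neg f)).2 hl.2⟩
    | next s s₁ =>
      constructor
      · intro hl
        obtain ⟨rfl, hs, -⟩ := hsup _ hl
        refine ⟨rfl, hs, ?_⟩
        rintro rfl
        exact h.prop.1 _ ⟨hj, hl⟩
      · rintro ⟨rfl, hs, hne⟩
        exact AspClosed.neg_next_mem hc hs (by omega) hne hj
    | _ => exact ⟨hsup _, fun hl => hl.elim⟩

/-! ### Loop answer sets are answer sets -/

theorem IsAnswerChain.congr {P : Set (Law Act Flu)} {N : ℕ∞} {act : ℕ → Act}
    {st st' : ℕ → Set (FLit Flu)} (h : IsAnswerChain P N act st)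
    (hst : ∀ n : ℕ, (n : ℕ∞) ≤ N → st n = st' n) : IsAnswerChain P N act st' := by
  rw [isAnswerChain_iff] at h ⊢
  refine ⟨hst 0 (by simp) ▸ h.1, fun n hn => ?_⟩
  rw [← hst _ hn, ← hst n (le_trans (by exact_mod_cast n.le_succ) hn)]
  exact h.2 n hn

theorem stateOf_loopAnswerSet {C : Set (DLTL Act Flu)} {j : ℕ} {act : ℕ → Act}
    {st : ℕ → Set (FLit Flu)} {s : ℕ} (hs : s ≤ k + 1) :
    stateOf (loopAnswerSet A C k j act st) s = st s := by
  ext (f | f) <;> exact ⟨fun h => h.2, fun h => ⟨hs, h⟩⟩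

/-- Consistency and closure are checked atom by atom and rule by rule. For minimality, a closed `R'`
below `R` contains the actions and the back loop by the default rules, then the states by minimality
of the chain, and then everything derived from them. -/
theorem isAnswerSet_loopAnswerSet {j : ℕ} (hj : j ≤ k) {act : ℕ → Act} {st : ℕ → Set (FLit Flu)}
    (hchain : IsAnswerChain D.laws ((k + 1 : ℕ) : ℕ∞) act st) (hdiff : ¬ DiffLast k st j)
    (hC : ∀ γ ∈ D.constraints, (γ.term A).Eval D.constraints k j act st 0) :
    IsAnswerSet (D.tr A k) (loopAnswerSet A D.constraints k j act st) := by
  set R := loopAnswerSet A D.constraints k j act st with hR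
  have hmem : ∀ l, l ∈ R ↔ LoopLit D.constraints k j act st l := fun l => Iff.rfl
  have hst : ∀ s ≤ k + 1, stateOf R s = st s := fun s hs => stateOf_loopAnswerSet hs
  replace hchain : IsAnswerChain D.laws ((k + 1 : ℕ) : ℕ∞) act (stateOf R) :=
    hchain.congr fun n hn => (hst n (by exact_mod_cast hn)).symm
  refine ⟨⟨?_, aspClosed_aspReduct_iff.2 fun r hr hneg hpos => ?_⟩, ?_⟩
  · rintro x ⟨h₁, h₂⟩
    cases x with
    | occurs a s => exact h₂.2 h₁.2
    | holds f s => exact hchain.consistent s (by exact_mod_cast h₁.1) f ⟨h₁, h₂⟩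
    | next s s₁ =>
      obtain ⟨rfl, -, hne⟩ := h₂
      rcases h₁ with ⟨h₁, -⟩ | ⟨-, h₁⟩
      · omega
      · exact hne h₁
    | _ => exact h₂
  · rcases mem_tr_iff.1 hr with ⟨law, hlaw, hr⟩ | hr | hr | hr | hr | hr
    · exact (laws_closed_iff (R := R) (R' := R) (fun s hs => hs)
        (fun s hs a => ⟨fun h => h.2, fun h => ⟨hs, h⟩⟩)).2
        hchain.closed law hlaw r hr hneg hpos
    · cases hr <;> refine ⟨_, rfl, ?_⟩ <;> simp_all [LoopLit]
    · cases hr <;> refine ⟨_, rfl, ?_⟩ <;> simp_all [LoopLit]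
    · cases hr with
      | diff_pos f s hs =>
        simp [hmem, LoopLit] at hpos
        exact ⟨_, rfl, hs, f, .inl ⟨hpos.2.1.2, hpos.2.2⟩⟩
      | diff_neg f s hs =>
        simp [hmem, LoopLit] at hpos
        exact ⟨_, rfl, hs, f, .inr ⟨hpos.2.1, hpos.2.2.2⟩⟩
      | eq_last s hs =>
        simp [hmem, LoopLit] at hneg
        exact ⟨_, rfl, hs, hneg hs⟩
      | next_succ s hs => exact ⟨_, rfl, .inl ⟨hs, rfl⟩⟩
      | neg_next s s₁ hs hs₁ hne =>
        simp [hmem, LoopLit, NextState] at hpos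
        exact ⟨_, rfl, rfl, hs, fun h => hne (h.trans hpos.1.symm)⟩
      | next_last s hs =>
        simp [hmem, LoopLit] at hneg
        exact ⟨_, rfl, .inr ⟨rfl, hneg (by omega)⟩⟩
      | constraint s hs =>
        simp [hmem, LoopLit, NextState] at hpos hneg
        subst hpos
        exact (hdiff (hneg hj)).elim
    · cases hr with
      | until_final π q α β s hs =>
        simp [hmem, LoopLit] at hpos
        exact ⟨_, rfl, LoopUntil.final q s hpos.1 hpos.2⟩
      | until_step π q q₁ a α β s s₁ hs hs₁ =>
        simp [hmem, LoopLit] at hpos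
        obtain ⟨h₁, h₂, ⟨-, rfl⟩, h₃, h₄⟩ := hpos
        exact ⟨_, rfl, LoopUntil.step q q₁ s s₁ h₃ h₂ h₁ h₄⟩
      | _ => refine ⟨_, rfl, ?_⟩; simp_all [LoopLit, Term.Eval]
    · cases hr with
      | trans γ hγ π hπ q q₁ a h => exact ⟨_, rfl, ⟨γ, hγ, hπ⟩, h⟩
      | final γ hγ π hπ q h => exact ⟨_, rfl, ⟨γ, hγ, hπ⟩, h⟩
      | constraint γ hγ => exact (hneg _ (List.mem_singleton_self _) (hC γ hγ)).elim
  · rintro R' ⟨-, hc⟩ hle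
    have hocc : ∀ s ≤ k, CLit.pos (Atom.occurs (act s) s) ∈ R' := fun s hs =>
      hc.occurs_mem hs fun h => h.2 rfl
    have hnext : CLit.pos (Atom.next k j) ∈ R' := hc.next_mem hj fun h => h.2.2 rfl
    have hst' : ∀ s ≤ k + 1, st s ⊆ stateOf R' s := fun s hs => by
      rw [← hst s hs]
      refine hchain.minimal (stateOf R') (fun s l hl => hle hl) ?_ s (by exact_mod_cast hs)
      refine (laws_closed_iff (fun s hs => hc.state_mem hs) fun s hs a => ?_).1
        fun law hlaw r hr => aspClosed_aspReduct_iff.1 hc r (mem_tr_iff.2 (.inl ⟨law, hlaw, hr⟩))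
      -- Since `R'` lies below `R`, no action other than `act s` can occur in it.
      exact ⟨fun ha => (hle ha).2, fun ha => ha ▸ hocc s hs⟩
    have hsat : ∀ (t : Term A Flu) s, t.Eval D.constraints k j act st s →
        CLit.pos (Atom.sat t s) ∈ R' := by
      intro t
      induction t with
      | top => exact fun s => hc.sat_top_mem
      | bot => exact fun s => False.elim
      | fluent p => exact fun s hs => hc.sat_fluent_mem hs.1 (hst' s hs.1 hs.2)
      -- Default negation is evaluated in `R`, not in `R'`, so no induction hypothesis is needed.
      | neg α _ => exact fun s hs => hc.sat_neg_mem hs.1 hs.2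
      | or α β ihα ihβ =>
        exact fun s hs => hc.sat_or_mem (Term.Eval.le hs) (hs.imp (ihα s) (ihβ s))
      | _ π q α β ihα ihβ =>
        exact fun s hs => hc.sat_until_mem hj hocc hnext ihα (fun s hs => ⟨hs.le, ihβ s hs⟩) hs
    rintro (x | x) hl
    · cases x with
      | state s => exact hc.state_mem hl
      | action a => exact hc.action_mem a
      | fluent f => exact hc.fluent_mem f
      | occurs a s =>
        obtain ⟨hs, rfl⟩ := hl
        exact hocc s hs
      | holds f s => exact hst' s hl.1 hl.2
      | diffLast s =>
        obtain ⟨hs, f, hf⟩ := hl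
        exact hc.diffLast_mem hs ⟨f, hf.imp
          (fun h => ⟨hst' s (by omega) h.1, hst' _ le_rfl h.2⟩)
          (fun h => ⟨hst' _ le_rfl h.1, hst' s (by omega) h.2⟩)⟩
      | eqLast s => exact hc.eqLast_mem hl.1 fun h => hl.2 h.2
      | next s s₁ =>
        rcases hl with ⟨hs, rfl⟩ | ⟨rfl, rfl⟩
        · exact hc.next_succ_mem hs
        · exact hnext
      | trans π q a q₁ => exact hc.trans_mem hl
      | final π q => exact hc.final_mem hl
      | sat t s => exact hsat t s hl
    · cases x with
      | occurs a s => exact hc.neg_occurs_mem hl.1 hl.2 (hocc s hl.1)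
      | holds f s => exact hst' s hl.1 hl.2
      | next s s₁ =>
        obtain ⟨rfl, hs, hne⟩ := hl
        exact hc.neg_next_mem hs (by omega) hne hnext
      | _ => exact hl.elim

end Program

/-! ### Paths with a back loop -/

section Loop

variable {k j : ℕ}

theorem loopState_le (hj : j ≤ k) (n : ℕ) : loopState k j n ≤ k := by
  unfold loopState
  split
  · omega
  · have := Nat.mod_lt (n - j) (show 0 < k + 1 - j by omega)
    omega

theorem loopState_of_le (hj : j ≤ k) {n : ℕ} (hn : n ≤ k) : loopState k j n = n := by
  unfold loopState
  split
  · rfl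
  · rw [Nat.mod_eq_of_lt (by omega)]
    omega

theorem loopState_add_period {n : ℕ} (hn : j ≤ n) :
    loopState k j (n + (k + 1 - j)) = loopState k j n := by
  unfold loopState
  rw [if_neg (by omega), if_neg (by omega),
    show n + (k + 1 - j) - j = n - j + (k + 1 - j) by omega, Nat.add_mod_right]

/-- Induction along a path with a back loop from `k` to `j`. -/
theorem loop_induction (hj : j ≤ k) {X : ℕ → Prop} (base : ∀ n ≤ k, X n)
    (step : ∀ n, j ≤ n → X n → X (n + (k + 1 - j))) (n : ℕ) : X n := by
  induction n using Nat.strong_induction_on with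
  | _ n ih =>
    by_cases hn : n ≤ k
    · exact base n hn
    · have := step (n - (k + 1 - j)) (by omega) (ih _ (by omega))
      rwa [Nat.sub_add_cancel (by omega)] at this

theorem nextState_loopState (hj : j ≤ k) (n : ℕ) :
    NextState k j (loopState k j n) (loopState k j (n + 1)) := by
  induction n using loop_induction hj with
  | base n hn =>
    rw [loopState_of_le hj hn]
    rcases hn.lt_or_eq with h | rfl
    · exact .inl ⟨h, loopState_of_le hj h⟩
    -- Time `k + 1` is `j` plus one period, hence folds back to `j`.
    · refine .inr ⟨rfl, ?_⟩
      have := loopState_add_period (k := n) (le_refl j)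
      rwa [loopState_of_le hj hj, show j + (n + 1 - j) = n + 1 by omega] at this
  | step n hn ih =>
    rw [loopState_add_period hn, show n + (k + 1 - j) + 1 = n + 1 + (k + 1 - j) by omega,
      loopState_add_period (by omega)]
    exact ih

theorem NextState.eq {s s₁ s₂ : ℕ} (h₁ : NextState k j s s₁) (h₂ : NextState k j s s₂) :
    s₁ = s₂ := by
  rcases h₁ with ⟨h₁, rfl⟩ | ⟨rfl, rfl⟩ <;> rcases h₂ with ⟨h₂, rfl⟩ | ⟨h₂, rfl⟩ <;> omega

variable {Act Flu : Type*} {A : ∀ π : Prg Act, Automaton π}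

theorem Model.IsKLoop.eq_loopState {M : Model Act Flu} (h : M.IsKLoop k j) (n : ℕ) :
    M.σ n = M.σ (loopState k j n) ∧ M.V n = M.V (loopState k j n) := by
  induction n using loop_induction h.1 with
  | base n hn => rw [loopState_of_le h.1 hn]; exact ⟨rfl, rfl⟩
  | step n hn ih => rwa [loopState_add_period hn, (h.2 n hn).1, (h.2 n hn).2]

/-! ### Satisfaction of formulas and of terms -/

theorem segment_succ (σ : ℕ → Act) (n m : ℕ) :
    segment σ n (m + 1) = σ n :: segment σ (n + 1) m := by
  simp [segment, List.range_succ_eq_map, Function.comp_def, Nat.add_comm, Nat.add_left_comm]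

theorem mem_acceptsFrom_iff_exists {α σ : Type*} {M : NFA α σ} {S : Set σ} {x : List α} :
    x ∈ M.acceptsFrom S ↔ ∃ q ∈ S, x ∈ M.acceptsFrom {q} := by
  simp only [NFA.mem_acceptsFrom, NFA.mem_evalFrom_iff_exists (S := S)]
  tauto

/-- A derivation of `LoopUntil` from `q` is an accepting run along the word read from time `n`, and
`m` is its length. The initial states `I` play no role, since the run starts in `q`. -/
theorem loopUntil_iff {Q : Type*} (hj : j ≤ k) {act σ : ℕ → Act} {δ : Q → Act → Set Q}
    {F I : Set Q} {α β : ℕ → Prop} (hσ : ∀ n, σ n = act (loopState k j n)) {q : Q} {n : ℕ} :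
    LoopUntil k j act δ F α β q (loopState k j n) ↔
      ∃ m, segment σ n m ∈ (NFA.mk δ I F).acceptsFrom {q} ∧ β (loopState k j (n + m)) ∧
        ∀ i < m, α (loopState k j (n + i)) := by
  constructor
  · intro h
    -- Many times fold to the same state, so the induction is on the derivation with `n` varying;
    -- determinism of `NextState` then lets time advance to `n + 1`.
    generalize hs : loopState k j n = s at h
    induction h generalizing n with
    | final q s hq hβ =>
      subst hs
      exact ⟨0, by simpa [segment] using hq, hβ, by simp⟩
    | step q q₁ s s₁ hn hq hα _ ih =>
      subst hs
      obtain ⟨m, h₁, h₂, h₃⟩ := ih (n := n + 1) ((nextState_loopState hj n).eq hn)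
      refine ⟨m + 1, ?_, ?_, ?_⟩
      · rw [segment_succ, NFA.cons_mem_acceptsFrom, mem_acceptsFrom_iff_exists]
        exact ⟨q₁, by simpa [hσ] using hq, h₁⟩
      · rwa [Nat.add_assoc, Nat.add_comm 1 m] at h₂
      · intro i hi
        cases i with
        | zero => exact hα
        | succ i =>
          have := h₃ i (by omega)
          rwa [Nat.add_assoc, Nat.add_comm 1 i] at this
  · rintro ⟨m, h₁, h₂, h₃⟩
    induction m generalizing n q with
    | zero => exact .final q _ (by simpa [segment] using h₁) h₂
    | succ m ih =>
      rw [segment_succ, NFA.cons_mem_acceptsFrom, mem_acceptsFrom_iff_exists] at h₁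
      obtain ⟨q₁, hq, h₁⟩ := h₁
      refine .step q q₁ _ _ (nextState_loopState hj n) (by simpa [hσ] using hq)
        (h₃ 0 (by omega)) (ih h₁ ?_ fun i hi => ?_)
      · rwa [Nat.add_assoc, Nat.add_comm 1 m]
      · rw [Nat.add_assoc, Nat.add_comm 1 i]
        exact h₃ _ (by omega)

/-- The program has facts only for automata indexed by the constraints; `hγ` ensures that those in
`γ` are among them, so their transitions and final states are fully described. -/
theorem Model.sat_iff_eval (hj : j ≤ k) {C : Set (DLTL Act Flu)} {act : ℕ → Act}
    {st : ℕ → Set (FLit Flu)} {M : Model Act Flu} (hσ : ∀ n, M.σ n = act (loopState k j n))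
    (hV : ∀ n p, p ∈ M.V n ↔ FLit.pos p ∈ st (loopState k j n)) (γ : DLTL Act Flu)
    (hγ : ∀ π ∈ γ.programs, ∃ γ' ∈ C, π ∈ γ'.programs) (n : ℕ) :
    M.Sat n γ ↔ (γ.term A).Eval C k j act st (loopState k j n) := by
  have hle : ∀ n, loopState k j n ≤ k + 1 := fun n => (loopState_le hj n).trans (Nat.le_succ k)
  induction γ generalizing n with
  | top => exact ⟨fun _ => hle n, fun _ => trivial⟩
  | bot => rfl
  | fluent p => exact (hV n p).trans (and_iff_right (hle n)).symm
  | neg α ih => exact (not_congr (ih hγ n)).trans (and_iff_right (hle n)).symm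
  | or α β ihα ihβ =>
    exact or_congr (ihα (fun π hπ => hγ π (.inl hπ)) n) (ihβ (fun π hπ => hγ π (.inr hπ)) n)
  | _ π α β ihα ihβ =>
    have hex := hγ π (.inl (.inl rfl))
    have hδ : transOf A C π = (A π).δ := by
      ext q a q₁
      exact and_iff_right hex
    have hF : finalOf A C π = (A π).final := by
      ext q
      exact and_iff_right hex
    simp only [Model.Sat, DLTL.term, Term.Eval, hδ, hF]
    rw [loopUntil_iff (I := {(A π).q₀}) hj hσ, ← (A π).recognizes,
      NFA.accepts_eq_acceptsFrom_start]
    simp only [ihα (fun π hπ => hγ π (.inl (.inr hπ))), ihβ (fun π hπ => hγ π (.inr hπ))]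

/-! ### Unrolling a path with a back loop -/

/-- The temporal interpretation that follows the states of a path with a back loop from `k` to
`j`. -/
def unroll (k j : ℕ) (act : ℕ → Act) (st : ℕ → Set (FLit Flu)) : TInterp Act Flu where
  σ n := act (loopState k j n)
  S := {x | x.2 ∈ st (loopState k j x.1)}

/-- Every transition of the unrolled path is one of the given path, the transition from `k` to `k +
1` also serving as the one from `k` to `j`. This requires the two states to be equal as sets of
literals. -/
theorem isTemporalAnswerSet_unroll {P : Set (Law Act Flu)} (hj : j ≤ k) {act : ℕ → Act}
    {st : ℕ → Set (FLit Flu)} (h : IsAnswerChain P ((k + 1 : ℕ) : ℕ∞) act st)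
    (hst : st (k + 1) = st j) : IsTemporalAnswerSet P ⊤ (unroll k j act st) := by
  rw [isAnswerChain_iff] at h
  refine isTemporalAnswerSet_iff.2 ⟨fun _ _ _ => le_top, isAnswerChain_iff.2 ⟨?_, fun n _ => ?_⟩⟩
  · have : slice (unroll k j act st).S 0 = st 0 := by
      change st (loopState k j 0) = _
      rw [loopState_of_le hj (Nat.zero_le k)]
    exact this ▸ h.1
  · change IsStep P (st (loopState k j n)) (act (loopState k j n)) (st (loopState k j (n + 1)))
    have hn := loopState_le hj n
    have hs := h.2 (loopState k j n) (by exact_mod_cast Nat.succ_le_succ hn)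
    rcases nextState_loopState hj n with ⟨-, h₁⟩ | ⟨h₁, h₂⟩
    · rwa [h₁]
    · rw [h₁, hst] at hs
      rwa [h₂, h₁]

theorem isKLoop_model_unroll (hj : j ≤ k) (act : ℕ → Act) (st : ℕ → Set (FLit Flu)) :
    (unroll k j act st).model.IsKLoop k j := by
  refine ⟨hj, fun n hn => ⟨?_, ?_⟩⟩
  · change act _ = act _
    rw [loopState_add_period hn]
  · ext p
    change FLit.pos p ∈ st (loopState k j (n + (k + 1 - j))) ↔ FLit.pos p ∈ st (loopState k j n)
    rw [loopState_add_period hn]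

/-! ### Total interpretations -/

theorem IsTotal.neg_mem_iff {I : TInterp Act Flu} (ht : IsTotal ⊤ I) (hp : IsPartialInterp ⊤ I)
    (n : ℕ) (f : Flu) : (n, FLit.neg f) ∈ I.S ↔ (n, FLit.pos f) ∉ I.S :=
  ⟨fun h h' => hp.2 n f ⟨h', h⟩, fun h => (ht n le_top f).resolve_left h⟩

/-- Valuations record only positive literals; totality and consistency recover the negative ones. -/
theorem IsTotal.slice_eq {I : TInterp Act Flu} (ht : IsTotal ⊤ I) (hp : IsPartialInterp ⊤ I)
    {n m : ℕ} (h : I.model.V n = I.model.V m) : slice I.S n = slice I.S m := by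
  have hpos : ∀ f, (n, FLit.pos f) ∈ I.S ↔ (m, FLit.pos f) ∈ I.S := fun f => Set.ext_iff.1 h f
  ext (f | f)
  · exact hpos f
  · simp only [mem_slice, ht.neg_mem_iff hp, hpos]

theorem IsTotal.ext {I J : TInterp Act Flu} (hI : IsTotal ⊤ I) (hpI : IsPartialInterp ⊤ I)
    (hJ : IsTotal ⊤ J) (hpJ : IsPartialInterp ⊤ J) (h : I.model = J.model) : I = J := by
  have hpos : ∀ n f, (n, FLit.pos f) ∈ I.S ↔ (n, FLit.pos f) ∈ J.S := fun n f =>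
    Set.ext_iff.1 (congrFun (congrArg Model.V h) n) f
  refine TInterp.ext (congrArg Model.σ h) ?_
  ext ⟨n, f | f⟩
  · exact hpos n f
  · simp only [hI.neg_mem_iff hpI, hJ.neg_mem_iff hpJ, hpos]

theorem IsTemporalAnswerSet.isPartialInterp {P : Set (Law Act Flu)} {N : ℕ∞}
    {I : TInterp Act Flu} (h : IsTemporalAnswerSet P N I) : IsPartialInterp N I := h.prop.1

end Loop

/-! ### The correspondence -/

section Correspondence

variable {Act Flu : Type*} {A : ∀ π : Prg Act, Automaton π} {D : DomainDescription Act Flu}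
  {k j : ℕ}

/-- The answer set of the translation that corresponds to a `k`-loop with back loop to `j`. -/
def TInterp.loopAnswerSet (A : ∀ π : Prg Act, Automaton π) (D : DomainDescription Act Flu)
    (k : ℕ) (I : TInterp Act Flu) (j : ℕ) : Set (CLit (Atom A Flu)) :=
  TemporalASP.loopAnswerSet A D.constraints k j I.σ (slice I.S)

/-- The extension is truncated after `k + 1` actions. Periodicity at time `j` and totality make
states `j` and `k + 1` equal, so consistency excludes complementary literals. -/
theorem DomainDescription.IsExtension.isAnswerSet {I : TInterp Act Flu} (hI : D.IsExtension I)
    (hl : I.model.IsKLoop k j) : IsAnswerSet (D.tr A k) (I.loopAnswerSet A D k j) := by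
  obtain ⟨has, htot, hC⟩ := hI
  refine isAnswerSet_loopAnswerSet hl.1 ((isTemporalAnswerSet_iff.1 has).2.of_le le_top) ?_
    fun γ hγ => ?_
  · have hV := (hl.2 j le_rfl).2
    rw [show j + (k + 1 - j) = k + 1 by have := hl.1; omega] at hV
    rintro ⟨f, hf⟩
    rw [htot.slice_eq has.isPartialInterp hV] at hf
    exact has.isPartialInterp.2 j f (hf.elim id id)
  · have := (Model.sat_iff_eval (A := A) (C := D.constraints) (act := I.σ) (st := slice I.S) hl.1
      (fun n => (hl.eq_loopState n).1) (fun n p => by rw [(hl.eq_loopState n).2]; rfl) γ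
      (fun π hπ => ⟨γ, hγ, hπ⟩) 0).1 (hC γ hγ)
    rwa [loopState_of_le hl.1 (Nat.zero_le k)] at this

theorem DomainDescription.IsExtension.hasCompleteStates {I : TInterp Act Flu}
    (hI : D.IsExtension I) : HasCompleteStates k (I.loopAnswerSet A D k j) := fun s hs f =>
  (hI.2.1 s le_top f).imp (fun h => ⟨hs, h⟩) (fun h => ⟨hs, h⟩)

theorem isAssociatedModel_loopAnswerSet {I : TInterp Act Flu} (hl : I.model.IsKLoop k j) :
    IsAssociatedModel k j (I.loopAnswerSet A D k j) I.model := by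
  refine ⟨hl.1, .inr ⟨rfl, rfl⟩, fun n => ⟨⟨loopState_le hl.1 n, (hl.eq_loopState n).1⟩,
    fun p => ?_⟩⟩
  rw [(hl.eq_loopState n).2]
  exact ⟨fun h => ⟨(loopState_le hl.1 n).trans (Nat.le_succ k), h⟩, fun h => h.2⟩

/-- An answer set determines its associated temporal model. -/
theorem IsAnswerSet.associatedModel_unique [Nonempty Act] {R : Set (CLit (Atom A Flu))}
    (h : IsAnswerSet (D.tr A k) R) {i : ℕ} {M M' : Model Act Flu}
    (hM : IsAssociatedModel k j R M) (hM' : IsAssociatedModel k i R M') : j = i ∧ M = M' := by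
  obtain rfl := h.next_unique hM.2.1 hM'.2.1
  obtain ⟨act, hocc⟩ := h.exists_action
  refine ⟨rfl, Model.ext (funext fun n => ?_) (funext fun n => Set.ext fun p => ?_)⟩
  · have hn := loopState_le hM.1 n
    rw [(hocc _ hn _).1 (hM.2.2 n).1, (hocc _ hn _).1 (hM'.2.2 n).1]
  · rw [(hM.2.2 n).2, (hM'.2.2 n).2]

/-- For complete, consistent states, having no complementary literals is the same as being equal. -/
theorem IsAnswerSet.isLoopClosed {R : Set (CLit (Atom A Flu))} (h : IsAnswerSet (D.tr A k) R)
    (hR : HasCompleteStates k R) : IsLoopClosed k R := by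
  intro j hj
  have hjk := h.next_le hj
  have hd := h.not_diffLast hj
  have key : ∀ f, (CLit.pos (Atom.holds f j) ∈ R ↔ CLit.pos (Atom.holds f (k + 1)) ∈ R) ∧
      (CLit.neg (Atom.holds f j) ∈ R ↔ CLit.neg (Atom.holds f (k + 1)) ∈ R) := by
    intro f
    have h₁ := hR j (by omega) f
    have h₂ := hR (k + 1) le_rfl f
    have h₃ := h.prop.1 (Atom.holds f j)
    have h₄ := h.prop.1 (Atom.holds f (k + 1))
    have h₅ : ¬ (CLit.pos (Atom.holds f j) ∈ R ∧ CLit.neg (Atom.holds f (k + 1)) ∈ R) :=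
      fun hf => hd ⟨f, .inl hf⟩
    have h₆ : ¬ (CLit.pos (Atom.holds f (k + 1)) ∈ R ∧ CLit.neg (Atom.holds f j) ∈ R) :=
      fun hf => hd ⟨f, .inr hf⟩
    tauto
  rintro (f | f)
  · exact (key f).1
  · exact (key f).2

theorem IsAnswerSet.isTemporalAnswerSet_unroll {R : Set (CLit (Atom A Flu))}
    (h : IsAnswerSet (D.tr A k) R) {act : ℕ → Act}
    (hocc : ∀ s ≤ k, ∀ a, CLit.pos (Atom.occurs a s) ∈ R ↔ a = act s)
    (hj : CLit.pos (Atom.next k j) ∈ R) (hR : IsLoopClosed k R) :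
    IsTemporalAnswerSet D.laws ⊤ (unroll k j act (stateOf R)) :=
  TemporalASP.isTemporalAnswerSet_unroll (h.next_le hj) (h.isAnswerChain hocc)
    (Set.ext fun l => (hR j hj l).symm)

/-- The path unrolls to an infinite temporal answer set, total by well-definedness. This covers the
states up to `k`, and loop closure carries completeness from `j` to `k + 1`. -/
theorem IsAnswerSet.hasCompleteStates_of_isLoopClosed [Nonempty Act] (hD : D.WellDefined)
    {R : Set (CLit (Atom A Flu))} (h : IsAnswerSet (D.tr A k) R) (hR : IsLoopClosed k R) :
    HasCompleteStates k R := by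
  obtain ⟨act, hocc⟩ := h.exists_action
  obtain ⟨j, hjk, hj⟩ := h.exists_next
  have ht := hD _ (h.isTemporalAnswerSet_unroll hocc hj hR)
  have key : ∀ s ≤ k, ∀ f, CLit.pos (Atom.holds f s) ∈ R ∨ CLit.neg (Atom.holds f s) ∈ R := by
    intro s hs f
    have : FLit.pos f ∈ stateOf R (loopState k j s) ∨ FLit.neg f ∈ stateOf R (loopState k j s) :=
      ht s le_top f
    rwa [loopState_of_le hjk hs] at this
  intro s hs f
  rcases Nat.le_succ_iff.1 hs with hs | rfl
  · exact key s hs f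
  · exact (key j hjk f).imp (hR j hj (.pos f)).1 (hR j hj (.neg f)).1

theorem IsAnswerSet.hasCompleteStates_of_finitelyTotal [Nonempty Act] (hD : D.FinitelyTotal)
    {R : Set (CLit (Atom A Flu))} (h : IsAnswerSet (D.tr A k) R) : HasCompleteStates k R := by
  obtain ⟨act, hocc⟩ := h.exists_action
  -- The cut at `k + 1` is needed because an interpretation over a finite word has no literals past
  -- its end.
  let I : TInterp Act Flu := ⟨act, {x | x.1 ≤ k + 1 ∧ x.2 ∈ stateOf R x.1}⟩
  have hI : IsTemporalAnswerSet D.laws ((k + 1 : ℕ) : ℕ∞) I := by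
    refine isTemporalAnswerSet_iff.2 ⟨fun n l hl => by exact_mod_cast hl.1,
      (h.isAnswerChain hocc).congr fun n hn => Set.ext fun l => ?_⟩
    exact (and_iff_right (by exact_mod_cast hn)).symm
  exact fun s hs f => (hD _ I hI s (by exact_mod_cast hs) f).imp (fun h => h.2) fun h => h.2

/-- Every answer set with complete states comes from an extension. -/
theorem IsAnswerSet.exists_extension [Nonempty Act] {R : Set (CLit (Atom A Flu))}
    (h : IsAnswerSet (D.tr A k) R) (hR : HasCompleteStates k R) :
    ∃ (I : TInterp Act Flu) (j : ℕ), D.IsExtension I ∧ I.model.IsKLoop k j ∧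
      I.loopAnswerSet A D k j = R := by
  obtain ⟨act, hocc⟩ := h.exists_action
  obtain ⟨j, hjk, hj⟩ := h.exists_next
  have hloop := h.isLoopClosed hR
  -- Unrolling replaces state `k + 1` by state `j`; their equality is what lets `R` be recovered
  -- from the unrolled interpretation.
  have hst : ∀ s ≤ k + 1, stateOf R s = stateOf R (loopState k j s) := by
    intro s hs
    rcases Nat.le_succ_iff.1 hs with hs | rfl
    · rw [loopState_of_le hjk hs]
    · have : loopState k j (k + 1) = j := by
        have := loopState_add_period (k := k) (le_refl j)
        rwa [loopState_of_le hjk hjk, show j + (k + 1 - j) = k + 1 by omega] at this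
      rw [this]
      exact Set.ext fun l => (hloop j hj l).symm
  refine ⟨unroll k j act (stateOf R), j, ⟨h.isTemporalAnswerSet_unroll hocc hj hloop, ?_, ?_⟩,
    isKLoop_model_unroll hjk _ _, (h.eq_loopAnswerSet ?_ hj ?_).symm⟩
  · exact fun n _ f => hR _ ((loopState_le hjk n).trans (Nat.le_succ k)) f
  · intro γ hγ
    rw [Model.sat_iff_eval (A := A) (C := D.constraints) (act := act) (st := stateOf R) hjk
      (fun n => rfl) (fun n p => Iff.rfl) γ (fun π hπ => ⟨γ, hγ, hπ⟩),
      loopState_of_le hjk (Nat.zero_le k), ← h.sat_iff hocc hj (fun _ _ => rfl)]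
    exact h.sat_term_mem hγ
  · intro s hs a
    change _ ↔ a = act (loopState k j s)
    rw [loopState_of_le hjk hs, hocc s hs]
  · exact hst

end Correspondence

end TemporalASP

/-! ### The bijection and the two criteria for complete states. -/

theorem mainTheorem3 {Act Flu : Type*} [Finite Act] [Nonempty Act]
    (A : ∀ π : TemporalASP.Prg Act, TemporalASP.Automaton π)
    (D : TemporalASP.DomainDescription Act Flu) (hD : D.WellDefined) (k : ℕ) :
    (∃ Φ : {x : TemporalASP.TInterp Act Flu × ℕ //
              D.IsExtension x.1 ∧ x.1.model.IsKLoop k x.2} ≃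
            {R : Set (TemporalASP.CLit (TemporalASP.Atom A Flu)) //
              TemporalASP.IsAnswerSet (D.tr A k) R ∧ TemporalASP.HasCompleteStates k R},
        ∀ x, TemporalASP.IsAssociatedModel k x.1.2 (Φ x).1 x.1.1.model) ∧
      (∀ R : Set (TemporalASP.CLit (TemporalASP.Atom A Flu)),
        TemporalASP.IsAnswerSet (D.tr A k) R →
          (TemporalASP.HasCompleteStates k R ↔ TemporalASP.IsLoopClosed k R)) ∧
      (D.FinitelyTotal → ∀ R : Set (TemporalASP.CLit (TemporalASP.Atom A Flu)),
        TemporalASP.IsAnswerSet (D.tr A k) R → TemporalASP.HasCompleteStates k R) := by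
  refine ⟨?_, fun R hR => ⟨hR.isLoopClosed, hR.hasCompleteStates_of_isLoopClosed hD⟩,
    fun hF R hR => hR.hasCompleteStates_of_finitelyTotal hF⟩
  refine ⟨Equiv.ofBijective
    (fun x => ⟨x.1.1.loopAnswerSet A D k x.1.2, x.2.1.isAnswerSet x.2.2,
      x.2.1.hasCompleteStates⟩) ⟨?_, ?_⟩,
    fun x => TemporalASP.isAssociatedModel_loopAnswerSet x.2.2⟩
  -- Injectivity: an answer set determines its back loop and temporal model, and a total
  -- interpretation is determined by its model.
  · rintro ⟨⟨I, i⟩, hI, hi⟩ ⟨⟨J, j⟩, hJ, hj⟩ e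
    have e' : I.loopAnswerSet A D k i = J.loopAnswerSet A D k j := congrArg Subtype.val e
    have hM := TemporalASP.isAssociatedModel_loopAnswerSet (A := A) (D := D) hi
    rw [e'] at hM
    obtain ⟨hij, hIJ⟩ := (hJ.isAnswerSet hj).associatedModel_unique hM
      (TemporalASP.isAssociatedModel_loopAnswerSet hj)
    exact Subtype.ext (Prod.ext
      (hI.2.1.ext hI.1.isPartialInterp hJ.2.1 hJ.1.isPartialInterp hIJ) hij)
  · rintro ⟨R, hR, hc⟩
    obtain ⟨I, j, hI, hj, e⟩ := hR.exists_extension hc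
    exact ⟨⟨⟨I, j⟩, hI, hj⟩, Subtype.ext e⟩
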